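/- Let $\mathcal H$ be a complex Hilbert space with unit sphere $\mathcal S$, and let $\mathcal R_1,\mathcal R_2$ be von Neumann algebras acting on $\mathcal H$ with $\mathcal R_1\subseteq\mathcal R_2'$. Let $\mathcal R_{12}=(\mathcal R_1\cup\mathcal R_2)''$ be the von Neumann algebra they generate. A Bell operator for $\mathcal R_{12}$ is an operator of the form $$\tfrac12\bigl[A_1(B_1+B_2)+A_2(B_1-B_2)\bigr],\qquad A_i=A_i^*\in\mathcal R_1,\ B_i=B_i^*\in\mathcal R_2,\ -I\le A_i,B_i\le I .$$ For a state $\omega$ of $\mathcal R_{12}$ put $\beta(\omega)=\sup\{|\omega(R)| : R \text{ a Bell operator for } \mathcal R_{12}\}$, and call $\omega$ Bell correlated if $\beta(\omega)>1$. For $x\in\mathcal S$ let $\omega_x$ be the state $A\mapsto\langle x,Ax\rangle$ of $\mathcal R_{12}$ (inner product linear in the second variable). Suppose that $\mathcal R_1,\mathcal R_2$ satisfy the Schlieder property: if $A\in\mathcal R_1$, $B\in\mathcal R_2$ and $AB=0$, then $A=0$ or $B=0$. Suppose also that $\mathcal R_1$ and $\mathcal R_2$ are both of infinite type, i.e. for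 $j=1,2$ there is $V\in\mathcal R_j$ with $V^*V=I$ such that $VV^*$ is a projection different from $I$. Then: 1. the set of all $x\in\mathcal S$ for which $\omega_x$ is Bell correlated is open and dense in $\mathcal S$ (in the norm topology of $\mathcal H$); 2. the set of normal Bell correlated states of $\mathcal R_{12}$ is norm dense in the set of all normal states of $\mathcal R_{12}$. Here a state $\omega$ is normal if $\omega(A_i)\to\omega(A)$ for every monotone increasing net $(A_i)$ of self-adjoint operators in $\mathcal R_{12}$ with least upper bound $A$. -/

import Mathlib

noncomputable section

namespace BellCorrelation

variable {H : Type*} [NormedAddCommGroup H] [InnerProductSpace ℂ H] [CompleteSpace H]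

/-- The von Neumann algebra `(R₁ ∪ R₂)''` generated by two von Neumann algebras. Since `R₁ ∪ R₂` is
closed under `star`, `StarSubalgebra.centralizer` is the ordinary commutant here. -/
def generated (R₁ R₂ : VonNeumannAlgebra H) : VonNeumannAlgebra H where
  toStarSubalgebra := StarSubalgebra.centralizer ℂ
    (StarSubalgebra.centralizer ℂ ((R₁ : Set (H →L[ℂ] H)) ∪ R₂) : Set (H →L[ℂ] H))
  centralizer_centralizer' := by simp

theorem coe_generated (R₁ R₂ : VonNeumannAlgebra H) :
    (generated R₁ R₂ : Set (H →L[ℂ] H)) =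
      Set.centralizer (Set.centralizer ((R₁ : Set (H →L[ℂ] H)) ∪ R₂)) := by
  have h : star ((R₁ : Set (H →L[ℂ] H)) ∪ R₂) = (R₁ : Set (H →L[ℂ] H)) ∪ R₂ := by
    rw [Set.union_star, StarMemClass.star_coe_eq, StarMemClass.star_coe_eq]
  change ((StarSubalgebra.centralizer ℂ
    (StarSubalgebra.centralizer ℂ ((R₁ : Set (H →L[ℂ] H)) ∪ R₂) : Set (H →L[ℂ] H)) :
      StarSubalgebra ℂ (H →L[ℂ] H)) : Set (H →L[ℂ] H)) = _
  rw [StarSubalgebra.coe_centralizer_centralizer, h, Set.union_self]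

/-- The Schlieder property: `A B = 0` with `A ∈ R₁` and `B ∈ R₂` forces `A = 0` or `B = 0`. -/
def SchliederProperty (R₁ R₂ : VonNeumannAlgebra H) : Prop :=
  ∀ A ∈ R₁, ∀ B ∈ R₂, A * B = 0 → A = 0 ∨ B = 0

/-- Murray-von Neumann equivalence of `E` and `F` in `R`, through a partial isometry of `R` with
initial projection `E` and final projection `F`. -/
def MurrayVonNeumannEquiv (R : VonNeumannAlgebra H) (E F : H →L[ℂ] H) : Prop :=
  ∃ V ∈ R, star V * V = E ∧ V * star V = F

/-- `R` is of infinite type: the identity is equivalent, in `R`, to a proper subprojection. -/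
def IsInfiniteType (R : VonNeumannAlgebra H) : Prop :=
  ∃ P ∈ R, IsStarProjection P ∧ P ≠ 1 ∧ MurrayVonNeumannEquiv R 1 P

/-- The bounded linear functionals on `R`, with the dual norm. -/
abbrev Functional (R : VonNeumannAlgebra H) : Type _ := StrongDual ℂ R.toStarSubalgebra

/-- A state of `R`: a positive linear functional with value `1` at the identity. Positive functionals
on `R` are automatically bounded. -/
structure IsState (R : VonNeumannAlgebra H) (ω : Functional R) : Prop where
  nonneg : ∀ A : R.toStarSubalgebra, 0 ≤ (ω (star A * A)).re ∧ (ω (star A * A)).im = 0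
  map_one : ω 1 = 1

/-- A normal state of `R`: a state such that `ω (A_i) → ω S` for every monotone increasing net
`A_i` of self-adjoint operators of `R` with least upper bound `S`. Nets are given as nonempty
directed sets `D`; since `ω` is monotone and real on self-adjoint operators, convergence of the net
means that `ω S` is the least upper bound of the values on `D`. -/
structure IsNormalState (R : VonNeumannAlgebra H) (ω : Functional R) : Prop extends
    IsState R ω where
  map_isLUB : ∀ (D : Set R.toStarSubalgebra) (S : R.toStarSubalgebra), D.Nonempty →
    (∀ A ∈ D, IsSelfAdjoint A) →
    DirectedOn (fun A B : R.toStarSubalgebra => (A : H →L[ℂ] H) ≤ (B : H →L[ℂ] H)) D →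
    (∀ A ∈ D, (A : H →L[ℂ] H) ≤ (S : H →L[ℂ] H)) →
    (∀ T : R.toStarSubalgebra, (∀ A ∈ D, (A : H →L[ℂ] H) ≤ (T : H →L[ℂ] H)) →
      (S : H →L[ℂ] H) ≤ (T : H →L[ℂ] H)) →
    IsLUB ((fun A => (ω A).re) '' D) (ω S).re

/-- The set of normal states of `R`, which as a subtype carries the norm topology. -/
def normalStateSpace (R : VonNeumannAlgebra H) : Set (Functional R) :=
  {ω | IsNormalState R ω}

/-- The functional `A ↦ ⟪x, A x⟫` on `R` (the inner product is linear in its second argument). It is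
a state when `x` is a unit vector. -/
def vectorFunctional (R : VonNeumannAlgebra H) (x : H) : Functional R :=
  ((innerSL ℂ x).comp (ContinuousLinearMap.apply ℂ H x)).comp
    (Submodule.subtypeL R.toStarSubalgebra.toSubmodule)

theorem vectorFunctional_apply (R : VonNeumannAlgebra H) (x : H) (A : R.toStarSubalgebra) :
    vectorFunctional R x A = inner ℂ x ((A : H →L[ℂ] H) x) := rfl

/-- The Bell operators `(1/2) (A₁ (B₁ + B₂) + A₂ (B₁ - B₂))`, with `A₁, A₂ ∈ R₁` and `B₁, B₂ ∈ R₂`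
self-adjoint contractions, as elements of `generated R₁ R₂`. -/
def bellOperators (R₁ R₂ : VonNeumannAlgebra H) : Set (generated R₁ R₂).toStarSubalgebra :=
  {R | ∃ A₁ ∈ R₁, ∃ A₂ ∈ R₁, ∃ B₁ ∈ R₂, ∃ B₂ ∈ R₂,
    (IsSelfAdjoint A₁ ∧ -1 ≤ A₁ ∧ A₁ ≤ 1) ∧ (IsSelfAdjoint A₂ ∧ -1 ≤ A₂ ∧ A₂ ≤ 1) ∧
    (IsSelfAdjoint B₁ ∧ -1 ≤ B₁ ∧ B₁ ≤ 1) ∧ (IsSelfAdjoint B₂ ∧ -1 ≤ B₂ ∧ B₂ ≤ 1) ∧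
    (R : H →L[ℂ] H) = (1 / 2 : ℂ) • (A₁ * (B₁ + B₂) + A₂ * (B₁ - B₂))}

/-- `β ω = sup {|ω R| : R a Bell operator}`. The set is nonempty and, as Bell operators have norm at
most `2`, bounded. -/
def beta (R₁ R₂ : VonNeumannAlgebra H) (ω : Functional (generated R₁ R₂)) : ℝ :=
  sSup ((fun R => ‖ω R‖) '' bellOperators R₁ R₂)

/-- `ω` is Bell correlated: `β ω > 1`. -/
def IsBellCorrelated (R₁ R₂ : VonNeumannAlgebra H) (ω : Functional (generated R₁ R₂)) : Prop :=
  1 < beta R₁ R₂ ω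

end BellCorrelation

end

/-!
Let `e ∈ R₁` and `f ∈ R₂` be partial isometries of square zero, with supports
`P = e*e + ee*` and `Q = f*f + ff*`. Each generates a copy of the `2 × 2` matrices, and the two
copies commute. The Pauli matrices of these copies that violate the Bell inequality maximally,
extended by the identity off `P` and `Q`, are self-adjoint unitaries, and they define a Bell
operator `bellOperator e f`. It is the identity on the projection `K = (1 - P)(1 - Q)`
(`bellOperator_mul_cutoff`) and has the eigenvalue `√2` on the vectors `u + e f u` with
`e*e f*f u = u` (`bellOperator_mul_entangler`), which are orthogonal to `K`. The Schlieder property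
gives a unit vector `y` of this kind. So a vector of `K H` or a state supported by `K`, where the
Bell operator has expectation `1`, becomes Bell correlated when any positive amount of `y` is added
(`isBellCorrelated_normalize`, `isBellCorrelated_perturb`).

A nonunitary isometry `V ∈ R₁` provides infinitely many such `e`, with orthogonal supports
(`shiftUnit` at even indices), and likewise for `R₂`. The values of any state on orthogonal
projections are summable, so along this sequence `ω (K n)` tends to `1` (`exists_cutoff_sequence`).
Hence `K n x → x` for every vector `x`, and `ω (K n · K n) → ω` in norm by Cauchy-Schwarz
(`IsState.norm_sub_compress_le`). This gives both density claims. Openness holds because Bell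
correlation of `ω_x` means `|⟪x, R x⟫| > 1` for some Bell operator `R`.

The perturbed states have to be normal again. Vigier's theorem (`exists_tendsto_of_monotone`) and
the strong closedness of a von Neumann algebra identify least upper bounds in the algebra with
strong limits. It follows that vector states are normal, and that `A ↦ K A K` respects least upper
bounds.
-/

open Filter Topology

noncomputable section

namespace BellCorrelation

/-! ### Partial isometries of square zero -/

section Star

variable {A : Type*} [Ring A] [StarRing A]

/-- `e` is a partial isometry of square zero. Then `star e * e`, `e * star e`, `e`, `star e` are the
matrix units of a copy of the `2 × 2` matrices, whose identity is `support e`. -/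
structure IsNilpotentPartialIsometry (e : A) : Prop where
  mul_self : e * e = 0
  mul_star_mul : e * star e * e = e

/-- The sum of the initial and the final projection of `e`; a projection when `e` is a partial
isometry of square zero. -/
def support (e : A) : A := star e * e + e * star e

/-- The Pauli matrix `σ_x` of the matrix units generated by `e`. -/
def pauliX (e : A) : A := e + star e

/-- The Pauli matrix `σ_z` of the matrix units generated by `e`, positive on the initial
projection of `e`. -/
def pauliZ (e : A) : A := star e * e - e * star e

variable {e : A}

theorem isSelfAdjoint_support (e : A) : IsSelfAdjoint (support e) := by
  simp [IsSelfAdjoint, support]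

theorem isSelfAdjoint_pauliX (e : A) : IsSelfAdjoint (pauliX e) := by
  simp [IsSelfAdjoint, pauliX, add_comm]

theorem isSelfAdjoint_pauliZ (e : A) : IsSelfAdjoint (pauliZ e) := by
  simp [IsSelfAdjoint, pauliZ]

namespace IsNilpotentPartialIsometry

theorem star_mul_star (h : IsNilpotentPartialIsometry e) : star e * star e = 0 := by
  rw [← star_mul, h.mul_self, star_zero]

theorem star_mul_mul_star (h : IsNilpotentPartialIsometry e) : star e * e * star e = star e := by
  simpa [mul_assoc] using congrArg star h.mul_star_mul

theorem mul_self_mul (h : IsNilpotentPartialIsometry e) (x : A) : e * (e * x) = 0 := by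
  rw [← mul_assoc, h.mul_self, zero_mul]

theorem star_mul_star_mul (h : IsNilpotentPartialIsometry e) (x : A) :
    star e * (star e * x) = 0 := by
  rw [← mul_assoc, h.star_mul_star, zero_mul]

theorem mul_star_mul_assoc (h : IsNilpotentPartialIsometry e) : e * (star e * e) = e := by
  rw [← mul_assoc, h.mul_star_mul]

theorem star_mul_mul_star_assoc (h : IsNilpotentPartialIsometry e) :
    star e * (e * star e) = star e := by
  rw [← mul_assoc, h.star_mul_mul_star]

theorem mul_star_mul_mul (h : IsNilpotentPartialIsometry e) (x : A) :
    e * (star e * (e * x)) = e * x := by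
  rw [← mul_assoc, ← mul_assoc, h.mul_star_mul]

theorem pauliX_mul_self (h : IsNilpotentPartialIsometry e) :
    pauliX e * pauliX e = support e := by
  simp only [pauliX, support, add_mul, mul_add, h.mul_self, h.star_mul_star]
  abel

theorem pauliZ_mul_self (h : IsNilpotentPartialIsometry e) :
    pauliZ e * pauliZ e = support e := by
  simp only [pauliZ, support, sub_mul, mul_sub, mul_assoc, h.mul_star_mul_assoc,
    h.star_mul_mul_star_assoc, h.mul_self_mul, h.star_mul_star_mul, mul_zero]
  abel

theorem pauliX_mul_pauliZ (h : IsNilpotentPartialIsometry e) :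
    pauliX e * pauliZ e + pauliZ e * pauliX e = 0 := by
  simp only [pauliX, pauliZ, add_mul, mul_add, sub_mul, mul_sub, mul_assoc, h.mul_self,
    h.star_mul_star, h.mul_star_mul_assoc, h.star_mul_mul_star_assoc, h.mul_self_mul,
    h.star_mul_star_mul, mul_zero]
  abel

theorem support_mul_self (h : IsNilpotentPartialIsometry e) :
    support e * support e = support e := by
  simp only [support, add_mul, mul_add, mul_assoc, h.mul_star_mul_assoc, h.star_mul_mul_star_assoc,
    h.mul_self_mul, h.star_mul_star_mul, mul_zero]
  abel

theorem pauliX_mul_support (h : IsNilpotentPartialIsometry e) :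
    pauliX e * support e = pauliX e := by
  simp only [pauliX, support, add_mul, mul_add, h.mul_star_mul_assoc, h.star_mul_mul_star_assoc,
    h.mul_self_mul, h.star_mul_star_mul]
  abel

theorem pauliZ_mul_support (h : IsNilpotentPartialIsometry e) :
    pauliZ e * support e = pauliZ e := by
  simp only [pauliZ, support, mul_add, sub_mul, mul_assoc, h.mul_star_mul_assoc,
    h.star_mul_mul_star_assoc, h.mul_self_mul, h.star_mul_star_mul, mul_zero]
  abel

/-- Replacing `support e` by a symmetry `X` of the corner in `1 = (1 - support e) + support e` gives
a symmetry of the whole algebra. -/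
theorem one_sub_support_add_mul_self (h : IsNilpotentPartialIsometry e) {X : A}
    (hX : X * X = support e) (hl : support e * X = X) (hr : X * support e = X) :
    (1 - support e + X) * (1 - support e + X) = 1 := by
  simp only [add_mul, mul_add, sub_mul, mul_sub, one_mul, mul_one, h.support_mul_self, hX, hl, hr]
  abel

end IsNilpotentPartialIsometry

/-- For an isometry `V` with defect projection `D = 1 - V V*`, the operator `Vⁿ (V D) V*ⁿ`. It maps
the defect space `Vⁿ D H` isometrically onto the orthogonal space `Vⁿ⁺¹ D H`. -/
def shiftUnit (V : A) (n : ℕ) : A := V ^ n * (V * (1 - V * star V)) * star V ^ n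

theorem star_pow_mul_pow {V : A} (hV : star V * V = 1) (n : ℕ) : star V ^ n * V ^ n = 1 := by
  induction n with
  | zero => simp
  | succ n ih =>
    rw [pow_succ, pow_succ', mul_assoc, ← mul_assoc (star V) V, hV, one_mul, ih]

theorem star_mul_mul {V : A} (hV : star V * V = 1) (x : A) : star V * (V * x) = x := by
  rw [← mul_assoc, hV, one_mul]

theorem star_pow_mul_pow_mul {V : A} (hV : star V * V = 1) (n : ℕ) (x : A) :
    star V ^ n * (V ^ n * x) = x := by
  rw [← mul_assoc, star_pow_mul_pow hV, one_mul]

theorem isNilpotentPartialIsometry_shiftUnit {V : A} (hV : star V * V = 1) (n : ℕ) :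
    IsNilpotentPartialIsometry (shiftUnit V n) := by
  constructor
  · simp only [shiftUnit, sub_mul, mul_sub, mul_assoc,
      mul_one, star_pow_mul_pow_mul hV, star_mul_mul hV]
    abel
  · simp only [shiftUnit, star_mul, star_sub, star_star, star_pow, sub_mul, mul_sub, mul_assoc,
      mul_one, star_pow_mul_pow_mul hV, star_mul_mul hV]
    abel

theorem star_shiftUnit_mul_self {V : A} (hV : star V * V = 1) (n : ℕ) :
    star (shiftUnit V n) * shiftUnit V n = V ^ n * (1 - V * star V) * star V ^ n := by
  simp only [shiftUnit, star_mul, star_sub, star_star, star_pow, sub_mul, mul_sub, mul_assoc,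
    mul_one, star_pow_mul_pow_mul hV, star_mul_mul hV]
  abel

theorem support_shiftUnit {V : A} (hV : star V * V = 1) (n : ℕ) :
    support (shiftUnit V n) = V ^ n * star V ^ n - V ^ (n + 2) * star V ^ (n + 2) := by
  rw [support, star_shiftUnit_mul_self hV, pow_add V, add_comm n 2, pow_add (star V),
    pow_two, pow_two]
  simp only [shiftUnit, star_mul, star_sub, star_star, star_pow, sub_mul, mul_sub, mul_assoc,
    mul_one, star_pow_mul_pow_mul hV, star_mul_mul hV]
  abel

theorem star_shiftUnit_mul_self_ne_zero {V : A} (hV : star V * V = 1) (hV' : V * star V ≠ 1)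
    (n : ℕ) : star (shiftUnit V n) * shiftUnit V n ≠ 0 := by
  rw [star_shiftUnit_mul_self hV]
  intro h0
  apply hV'
  have : star V ^ n * (V ^ n * (1 - V * star V) * star V ^ n) * V ^ n = 0 := by simp [h0]
  simp only [sub_mul, mul_sub, mul_assoc, mul_one, star_pow_mul_pow hV,
    star_pow_mul_pow_mul hV] at this
  exact (sub_eq_zero.1 this).symm

/-- The supports of the even-indexed `shiftUnit`s telescope, so that their partial sums stay below
`1`. -/
theorem sum_support_shiftUnit {V : A} (hV : star V * V = 1) (N : ℕ) :
    ∑ n ∈ Finset.range N, support (shiftUnit V (2 * n)) =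
      1 - V ^ (2 * N) * star V ^ (2 * N) := by
  induction N with
  | zero => simp
  | succ N ih =>
    rw [Finset.sum_range_succ, ih, support_shiftUnit hV, Nat.mul_succ]
    abel

/-! ### Commuting pairs: the cutoff projection and the entangled vectors -/

variable {f : A}

theorem commute_support (h : Commute e f) (h' : Commute e (star f)) :
    Commute (support e) (support f) := by
  have h1 : Commute (star e) f := by simpa using h'.star_star
  have h2 := h.star_star
  unfold support
  exact ((((h2.mul_right h1).mul_left (h'.mul_right h)).add_left
    ((h'.mul_right h).mul_left (h2.mul_right h1))).add_right
    (((h1.mul_right h2).mul_left (h.mul_right h')).add_left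
    ((h.mul_right h').mul_left (h1.mul_right h2))))

/-- The projection onto the vectors orthogonal to both supports (when these commute). -/
def cutoff (e f : A) : A := (1 - support e) * (1 - support f)

theorem isStarProjection_cutoff (h : Commute (support e) (support f))
    (he : IsNilpotentPartialIsometry e) (hf : IsNilpotentPartialIsometry f) :
    IsStarProjection (cutoff e f) := by
  have h1 : IsStarProjection (support e) := ⟨he.support_mul_self, isSelfAdjoint_support e⟩
  have h2 : IsStarProjection (support f) := ⟨hf.support_mul_self, isSelfAdjoint_support f⟩
  have hc : Commute (1 - support e) (1 - support f) :=
    (Commute.one_left _).sub_left ((Commute.one_right _).sub_right h)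
  exact h1.one_sub.mul h2.one_sub hc

/-- Maps a vector `u` fixed by both initial projections to `u + e f u`, a multiple of a maximally
entangled vector in the copy of `ℂ² ⊗ ℂ²` that `e`, `f` and `u` generate. -/
def entangler (e f : A) : A := (1 + e * f) * ((star e * e) * (star f * f))

/-- The range of `entangler e f` is fixed by `σ_x ⊗ σ_x`. -/
theorem pauliX_mul_pauliX_mul_entangler (h : Commute e f) (h' : Commute e (star f))
    (he : IsNilpotentPartialIsometry e) (hf : IsNilpotentPartialIsometry f) :
    pauliX e * (pauliX f * entangler e f) = entangler e f := by
  have c₁ : Commute f e := h.symm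
  have c₂ : Commute (star f) e := h'.symm
  have c₃ : Commute f (star e) := by simpa using h'.star_star.symm
  have c₄ : Commute (star f) (star e) := h.star_star.symm
  simp only [pauliX, entangler, add_mul, mul_add, mul_assoc, one_mul, he.mul_self_mul,
    he.star_mul_star_mul, he.mul_star_mul_mul, hf.mul_self, hf.mul_star_mul_assoc,
    hf.star_mul_star_mul, c₁.left_comm, c₂.left_comm, c₃.left_comm, c₄.left_comm, mul_zero]
  abel

/-- The range of `entangler e f` is fixed by `σ_z ⊗ σ_z`. -/
theorem pauliZ_mul_pauliZ_mul_entangler (h : Commute e f) (h' : Commute e (star f))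
    (he : IsNilpotentPartialIsometry e) (hf : IsNilpotentPartialIsometry f) :
    pauliZ e * (pauliZ f * entangler e f) = entangler e f := by
  have c₁ : Commute f e := h.symm
  have c₂ : Commute (star f) e := h'.symm
  have c₃ : Commute f (star e) := by simpa using h'.star_star.symm
  have c₄ : Commute (star f) (star e) := h.star_star.symm
  simp only [pauliZ, entangler, add_mul, mul_add, sub_mul, mul_sub, mul_assoc, one_mul,
    he.mul_self_mul, he.star_mul_star_mul, he.mul_star_mul_mul, hf.mul_self, hf.mul_star_mul_assoc,
    hf.star_mul_star_mul, c₁.left_comm, c₂.left_comm, c₃.left_comm, c₄.left_comm, mul_zero]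
  abel

theorem support_mul_pauliX_mul_entangler (h : Commute e f) (h' : Commute e (star f))
    (he : IsNilpotentPartialIsometry e) (hf : IsNilpotentPartialIsometry f) :
    support e * (pauliX f * entangler e f) = pauliX f * entangler e f := by
  have c₁ : Commute f e := h.symm
  have c₂ : Commute (star f) e := h'.symm
  have c₃ : Commute f (star e) := by simpa using h'.star_star.symm
  have c₄ : Commute (star f) (star e) := h.star_star.symm
  simp only [support, pauliX, entangler, add_mul, mul_add, mul_assoc, one_mul, he.mul_self_mul,
    he.star_mul_star_mul, he.mul_star_mul_mul, hf.mul_self, hf.mul_star_mul_assoc,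
    hf.star_mul_star_mul, c₁.left_comm, c₂.left_comm, c₃.left_comm, c₄.left_comm, mul_zero]
  abel

theorem support_mul_pauliZ_mul_entangler (h : Commute e f) (h' : Commute e (star f))
    (he : IsNilpotentPartialIsometry e) (hf : IsNilpotentPartialIsometry f) :
    support e * (pauliZ f * entangler e f) = pauliZ f * entangler e f := by
  have c₁ : Commute f e := h.symm
  have c₂ : Commute (star f) e := h'.symm
  have c₃ : Commute f (star e) := by simpa using h'.star_star.symm
  have c₄ : Commute (star f) (star e) := h.star_star.symm
  simp only [support, pauliZ, entangler, add_mul, mul_add, sub_mul, mul_sub, mul_assoc, one_mul,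
    he.mul_self_mul, he.star_mul_star_mul, he.mul_star_mul_mul, hf.mul_self, hf.mul_star_mul_assoc,
    hf.star_mul_star_mul, c₁.left_comm, c₂.left_comm, c₃.left_comm, c₄.left_comm, mul_zero]
  abel

theorem support_mul_entangler (h : Commute e f) (h' : Commute e (star f))
    (he : IsNilpotentPartialIsometry e) (hf : IsNilpotentPartialIsometry f) :
    support f * entangler e f = entangler e f := by
  have c₁ : Commute f e := h.symm
  have c₂ : Commute (star f) e := h'.symm
  have c₃ : Commute f (star e) := by simpa using h'.star_star.symm
  have c₄ : Commute (star f) (star e) := h.star_star.symm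
  simp only [support, entangler, add_mul, mul_add, mul_assoc, one_mul, he.mul_star_mul_mul,
    hf.mul_self, hf.mul_star_mul_assoc, hf.star_mul_star_mul, c₁.left_comm, c₂.left_comm,
    c₃.left_comm, c₄.left_comm, mul_zero]
  abel

/-- The term `e f u` of `u + e f u` is killed, as `e * e = 0`; so `entangler e f` is injective on
the range of the product of the initial projections. -/
theorem initial_mul_entangler (h : Commute e f) (h' : Commute e (star f))
    (he : IsNilpotentPartialIsometry e) (hf : IsNilpotentPartialIsometry f) :
    (star e * e) * (star f * f) * entangler e f = (star e * e) * (star f * f) := by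
  have c₁ : Commute f e := h.symm
  have c₂ : Commute (star f) e := h'.symm
  have c₃ : Commute f (star e) := by simpa using h'.star_star.symm
  have c₄ : Commute (star f) (star e) := h.star_star.symm
  simp only [entangler, add_mul, mul_add, mul_assoc, one_mul, he.mul_star_mul_mul, hf.mul_self,
    hf.mul_star_mul_assoc, c₁.left_comm, c₂.left_comm, c₃.left_comm, c₄.left_comm, mul_zero]
  abel

theorem cutoff_mul_entangler (h : Commute e f) (h' : Commute e (star f))
    (he : IsNilpotentPartialIsometry e) (hf : IsNilpotentPartialIsometry f) :
    cutoff e f * entangler e f = 0 := by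
  rw [cutoff, mul_assoc, sub_mul 1 (support f), support_mul_entangler h h' he hf, one_mul, sub_self,
    mul_zero]

end Star

/-! ### The Bell operator of a commuting pair -/

section Algebra

variable {A : Type*} [Ring A] [StarRing A] [Algebra ℂ A]

/-- The operator that is `X` on the support of `e` and the identity off it. -/
def reflect (e X : A) : A := 1 - support e + X

/-- `(σ_x + s σ_z) / √2`, the symmetry obtained for `s = ±1`. -/
def pauliXZ (s : ℂ) (f : A) : A :=
  ((√2 : ℝ) : ℂ)⁻¹ • (pauliX f + s • pauliZ f)

/-- The Bell operator of `A₁ = σ_x`, `A₂ = σ_z` (from `e`) and `B₁, B₂ = (σ_x ± σ_z) / √2` (from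
`f`), the choice of maximal violation, each extended by the identity off the support. -/
def bellOperator (e f : A) : A :=
  (1 / 2 : ℂ) •
    (reflect e (pauliX e) * (reflect f (pauliXZ 1 f) + reflect f (pauliXZ (-1) f)) +
      reflect e (pauliZ e) * (reflect f (pauliXZ 1 f) - reflect f (pauliXZ (-1) f)))

theorem sqrt_two_mul_self : ((√2 : ℝ) : ℂ) * ((√2 : ℝ) : ℂ) = 2 := by
  rw [← Complex.ofReal_mul, Real.mul_self_sqrt (by norm_num)]
  norm_num

theorem sqrt_two_ne_zero : ((√2 : ℝ) : ℂ) ≠ 0 := by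
  simp

theorem isSelfAdjoint_pauliXZ [StarModule ℂ A] (f : A) {s : ℂ} (hs : IsSelfAdjoint s) :
    IsSelfAdjoint (pauliXZ s f) := by
  refine IsSelfAdjoint.smul ?_ ((isSelfAdjoint_pauliX f).add (hs.smul (isSelfAdjoint_pauliZ f)))
  simp [IsSelfAdjoint]

theorem IsNilpotentPartialIsometry.pauliXZ_mul_self {f : A} (hf : IsNilpotentPartialIsometry f)
    {s : ℂ} (hs : s * s = 1) : pauliXZ s f * pauliXZ s f = support f := by
  have h3 : (pauliX f + s • pauliZ f) * (pauliX f + s • pauliZ f) = (2 : ℂ) • support f := by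
    calc _ = pauliX f * pauliX f + (s * s) • (pauliZ f * pauliZ f) +
          s • (pauliX f * pauliZ f + pauliZ f * pauliX f) := by
          simp only [add_mul, mul_add, smul_mul_assoc, mul_smul_comm, smul_add, smul_smul]
          abel
      _ = _ := by
          rw [hf.pauliX_mul_pauliZ, hs, hf.pauliX_mul_self, hf.pauliZ_mul_self, two_smul]
          simp
  rw [pauliXZ, smul_mul_smul_comm, h3, ← mul_inv, sqrt_two_mul_self, smul_smul]
  norm_num

theorem IsNilpotentPartialIsometry.pauliXZ_mul_support {f : A}
    (hf : IsNilpotentPartialIsometry f) (s : ℂ) : pauliXZ s f * support f = pauliXZ s f := by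
  rw [pauliXZ, smul_mul_assoc, add_mul, smul_mul_assoc, hf.pauliX_mul_support,
    hf.pauliZ_mul_support]

theorem reflect_pauliXZ_add (f : A) :
    reflect f (pauliXZ 1 f) + reflect f (pauliXZ (-1) f) =
      (2 : ℂ) • (1 - support f) + ((√2 : ℝ) : ℂ) • pauliX f := by
  have h : ((√2 : ℝ) : ℂ) = 2 * ((√2 : ℝ) : ℂ)⁻¹ := by
    rw [← sqrt_two_mul_self, mul_assoc, mul_inv_cancel₀ sqrt_two_ne_zero, mul_one]
  rw [h]
  simp only [reflect, pauliXZ, two_smul, mul_smul, one_smul, neg_smul, smul_add, smul_neg]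
  abel

theorem reflect_pauliXZ_sub (f : A) :
    reflect f (pauliXZ 1 f) - reflect f (pauliXZ (-1) f) = ((√2 : ℝ) : ℂ) • pauliZ f := by
  have h : ((√2 : ℝ) : ℂ) = 2 * ((√2 : ℝ) : ℂ)⁻¹ := by
    rw [← sqrt_two_mul_self, mul_assoc, mul_inv_cancel₀ sqrt_two_ne_zero, mul_one]
  rw [h]
  simp only [reflect, pauliXZ, two_smul, mul_smul, one_smul, neg_smul, smul_add, smul_neg]
  abel

/-- Off both supports all four observables are the identity, and the Bell operator is `1`. -/
theorem bellOperator_mul_cutoff {e f : A} (h : Commute (support e) (support f))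
    (he : IsNilpotentPartialIsometry e) (hf : IsNilpotentPartialIsometry f) :
    bellOperator e f * cutoff e f = cutoff e f := by
  have hc : (1 - support e) * (1 - support f) = (1 - support f) * (1 - support e) :=
    (Commute.one_left _).sub_left ((Commute.one_right _).sub_right h)
  have hP : (1 - support e) * (1 - support e) = 1 - support e := by
    simp [mul_sub, sub_mul, he.support_mul_self]
  have hQ : (1 - support f) * (1 - support f) = 1 - support f := by
    simp [mul_sub, sub_mul, hf.support_mul_self]
  have hX : pauliX e * (1 - support e) = 0 := by simp [mul_sub, he.pauliX_mul_support]
  have hX' : pauliX f * (1 - support f) = 0 := by simp [mul_sub, hf.pauliX_mul_support]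
  have hZ' : pauliZ f * (1 - support f) = 0 := by simp [mul_sub, hf.pauliZ_mul_support]
  have h1 : ((2 : ℂ) • (1 - support f) + ((√2 : ℝ) : ℂ) • pauliX f) * cutoff e f =
      (2 : ℂ) • cutoff e f := by
    rw [cutoff, hc, add_mul, smul_mul_assoc, smul_mul_assoc, ← mul_assoc, ← mul_assoc, hQ, hX']
    simp
  have h2 : pauliZ f * cutoff e f = 0 := by rw [cutoff, hc, ← mul_assoc, hZ', zero_mul]
  have h3 : reflect e (pauliX e) * cutoff e f = cutoff e f := by
    rw [cutoff, ← mul_assoc, reflect, add_mul, hP, hX, add_zero]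
  rw [bellOperator, reflect_pauliXZ_add, reflect_pauliXZ_sub, smul_mul_assoc, add_mul, mul_assoc,
    h1, mul_assoc, smul_mul_assoc, h2, mul_smul_comm, h3, smul_zero, mul_zero, add_zero, smul_smul]
  norm_num

/-- On the entangled vectors the Bell operator is `(σ_x ⊗ σ_x + σ_z ⊗ σ_z) / √2 = √2`. -/
theorem bellOperator_mul_entangler {e f : A} (h : Commute e f) (h' : Commute e (star f))
    (he : IsNilpotentPartialIsometry e) (hf : IsNilpotentPartialIsometry f) :
    bellOperator e f * entangler e f = ((√2 : ℝ) : ℂ) • entangler e f := by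
  have h1 : ((2 : ℂ) • (1 - support f) + ((√2 : ℝ) : ℂ) • pauliX f) * entangler e f =
      ((√2 : ℝ) : ℂ) • (pauliX f * entangler e f) := by
    rw [add_mul, smul_mul_assoc, sub_mul, support_mul_entangler h h' he hf]
    simp
  have h2 : reflect e (pauliX e) * (pauliX f * entangler e f) = entangler e f := by
    rw [reflect, add_mul, sub_mul, support_mul_pauliX_mul_entangler h h' he hf,
      pauliX_mul_pauliX_mul_entangler h h' he hf]
    simp
  have h3 : reflect e (pauliZ e) * (pauliZ f * entangler e f) = entangler e f := by
    rw [reflect, add_mul, sub_mul, support_mul_pauliZ_mul_entangler h h' he hf,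
      pauliZ_mul_pauliZ_mul_entangler h h' he hf]
    simp
  rw [bellOperator, reflect_pauliXZ_add, reflect_pauliXZ_sub, smul_mul_assoc, add_mul, mul_assoc,
    h1, mul_assoc, smul_mul_assoc, mul_smul_comm, mul_smul_comm, h2, h3, ← two_smul ℂ, smul_smul]
  norm_num

end Algebra

variable {H : Type*} [NormedAddCommGroup H] [InnerProductSpace ℂ H] [CompleteSpace H]
variable {R : VonNeumannAlgebra H} {e X : H →L[ℂ] H}

theorem neg_one_le_and_le_one_of_mul_self_eq_one {A : H →L[ℂ] H} (hA : IsSelfAdjoint A)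
    (h : A * A = 1) : IsSelfAdjoint A ∧ -1 ≤ A ∧ A ≤ 1 := by
  have key : ∀ B : H →L[ℂ] H, IsSelfAdjoint B → B * B = 1 → B ≤ 1 := by
    intro B hB h
    -- As `(1 - B)² = 2 (1 - B)`, the difference is half of a square.
    have h1 : (1 : H →L[ℂ] H) - B = (1 / 2 : ℂ) • (star (1 - B) * (1 - B)) := by
      rw [star_sub, star_one, hB.star_eq]
      have : (1 - B) * (1 - B) = (2 : ℂ) • (1 - B) := by
        simp only [sub_mul, mul_sub, one_mul, mul_one, h, two_smul]
        abel
      rw [this, smul_smul]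
      norm_num
    rw [ContinuousLinearMap.le_def, h1]
    exact (ContinuousLinearMap.isPositive_adjoint_comp_self (1 - B)).smul_of_nonneg (by
      rw [show (1 / 2 : ℂ) = ((1 / 2 : ℝ) : ℂ) by norm_num]
      exact Complex.zero_le_real.2 (by norm_num))
  refine ⟨hA, ?_, key A hA h⟩
  have := key (-A) hA.neg (by simpa using h)
  exact neg_le.1 this

theorem reflect_mem (he : e ∈ R) (hX : X ∈ R) :
    reflect e X ∈ R :=
  add_mem (sub_mem (one_mem R) (add_mem (mul_mem (star_mem he) he) (mul_mem he (star_mem he)))) hX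

theorem smul_mem_of_mem (R : VonNeumannAlgebra H) (c : ℂ) (hX : X ∈ R) : c • X ∈ R :=
  R.toStarSubalgebra.smul_mem hX c

theorem pauliX_mem (he : e ∈ R) : pauliX e ∈ R :=
  add_mem he (star_mem he)

theorem pauliZ_mem (he : e ∈ R) : pauliZ e ∈ R :=
  sub_mem (mul_mem (star_mem he) he) (mul_mem he (star_mem he))

theorem reflect_bounds (he : IsNilpotentPartialIsometry e)
    (hs : IsSelfAdjoint X) (hX : X * X = support e) (hr : X * support e = X) :
    IsSelfAdjoint (reflect e X) ∧ -1 ≤ reflect e X ∧ reflect e X ≤ 1 := by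
  have hl : support e * X = X := by
    simpa [(isSelfAdjoint_support e).star_eq, hs.star_eq] using congrArg star hr
  exact neg_one_le_and_le_one_of_mul_self_eq_one
    (((IsSelfAdjoint.one _).sub (isSelfAdjoint_support e)).add hs)
    (he.one_sub_support_add_mul_self hX hl hr)

theorem pauliXZ_mem (he : e ∈ R) (s : ℂ) :
    pauliXZ s e ∈ R :=
  smul_mem_of_mem R _ (add_mem (pauliX_mem he) (smul_mem_of_mem R s (pauliZ_mem he)))

theorem mem_generated_left (R₁ R₂ : VonNeumannAlgebra H) {A : H →L[ℂ] H} (hA : A ∈ R₁) :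
    A ∈ generated R₁ R₂ := by
  rw [← SetLike.mem_coe, coe_generated]
  exact Set.subset_centralizer_centralizer (Or.inl hA)

theorem mem_generated_right (R₁ R₂ : VonNeumannAlgebra H) {A : H →L[ℂ] H} (hA : A ∈ R₂) :
    A ∈ generated R₁ R₂ := by
  rw [← SetLike.mem_coe, coe_generated]
  exact Set.subset_centralizer_centralizer (Or.inr hA)

theorem exists_mem_bellOperators_coe_eq {R₁ R₂ : VonNeumannAlgebra H} {e f : H →L[ℂ] H}
    (he : e ∈ R₁) (hf : f ∈ R₂) (he' : IsNilpotentPartialIsometry e)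
    (hf' : IsNilpotentPartialIsometry f) :
    ∃ R ∈ bellOperators R₁ R₂, (R : H →L[ℂ] H) = bellOperator e f := by
  have hA₁ := reflect_mem he (pauliX_mem he)
  have hA₂ := reflect_mem he (pauliZ_mem he)
  have hB₁ := reflect_mem hf (pauliXZ_mem hf 1)
  have hB₂ := reflect_mem hf (pauliXZ_mem hf (-1))
  have h : bellOperator e f ∈ generated R₁ R₂ :=
    smul_mem_of_mem _ _ (add_mem
      (mul_mem (mem_generated_left _ _ hA₁) (mem_generated_right _ _ (add_mem hB₁ hB₂)))
      (mul_mem (mem_generated_left _ _ hA₂) (mem_generated_right _ _ (sub_mem hB₁ hB₂))))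
  refine ⟨⟨bellOperator e f, h⟩, ⟨_, hA₁, _, hA₂, _, hB₁, _, hB₂, ?_, ?_, ?_, ?_, rfl⟩, rfl⟩
  · exact reflect_bounds he' (isSelfAdjoint_pauliX e) he'.pauliX_mul_self he'.pauliX_mul_support
  · exact reflect_bounds he' (isSelfAdjoint_pauliZ e) he'.pauliZ_mul_self he'.pauliZ_mul_support
  · exact reflect_bounds hf' (isSelfAdjoint_pauliXZ f (by simp [IsSelfAdjoint]))
      (hf'.pauliXZ_mul_self (by norm_num)) (hf'.pauliXZ_mul_support _)
  · exact reflect_bounds hf' (isSelfAdjoint_pauliXZ f (by simp [IsSelfAdjoint]))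
      (hf'.pauliXZ_mul_self (by norm_num)) (hf'.pauliXZ_mul_support _)

theorem exists_unit_eigenvector_bellOperator {e f : H →L[ℂ] H} (h : Commute e f)
    (h' : Commute e (star f))
    (he : IsNilpotentPartialIsometry e) (hf : IsNilpotentPartialIsometry f)
    (hne : (star e * e) * (star f * f) ≠ 0) :
    ∃ y : H, ‖y‖ = 1 ∧ bellOperator e f y = ((√2 : ℝ) : ℂ) • y ∧ cutoff e f y = 0 := by
  obtain ⟨v, hv⟩ : ∃ v, ((star e * e) * (star f * f)) v ≠ 0 := by
    by_contra! hv
    exact hne (ContinuousLinearMap.ext hv)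
  have hw : entangler e f v ≠ 0 := by
    intro h0
    apply hv
    rw [← initial_mul_entangler h h' he hf]
    change (star e * e * (star f * f)) (entangler e f v) = 0
    rw [h0, map_zero]
  have h1 : bellOperator e f (entangler e f v) = ((√2 : ℝ) : ℂ) • entangler e f v :=
    congrArg (fun T : H →L[ℂ] H => T v) (bellOperator_mul_entangler h h' he hf)
  have h2 : cutoff e f (entangler e f v) = 0 :=
    congrArg (fun T : H →L[ℂ] H => T v) (cutoff_mul_entangler h h' he hf)
  refine ⟨((‖entangler e f v‖⁻¹ : ℝ) : ℂ) • entangler e f v, ?_, ?_, ?_⟩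
  · rw [norm_smul, Complex.norm_real, norm_inv, norm_norm, inv_mul_cancel₀ (norm_ne_zero_iff.2 hw)]
  · rw [map_smul, h1, smul_comm]
  · rw [map_smul, h2, smul_zero]

/-! ### States -/

section State

variable {ω : Functional R}

/-- A state is hermitian: polarize the reality of `ω (star B * B)` at `B = 1 + c • A`. -/
theorem IsState.map_star (hω : IsState R ω) (A : R.toStarSubalgebra) :
    ω (star A) = starRingEnd ℂ (ω A) := by
  have key : ∀ c : ℂ, (c * ω A + starRingEnd ℂ c * ω (star A)).im = 0 := by
    intro c
    have h1 := (hω.nonneg (1 + c • A)).2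
    have h2 : star (1 + c • A) * (1 + c • A) =
        star (1 : R.toStarSubalgebra) * 1 + (c • A + starRingEnd ℂ c • star A) +
          (starRingEnd ℂ c * c) • (star A * A) := by
      simp only [star_add, star_one, star_smul, add_mul, mul_add, one_mul, mul_one, smul_mul_assoc,
        mul_smul_comm, smul_smul, smul_add, mul_comm c, starRingEnd_apply]
      abel
    have h3 := (hω.nonneg A).2
    have h4 := (hω.nonneg 1).2
    rw [h2, map_add, map_add, map_add, map_smul, map_smul, map_smul,
      ← Complex.normSq_eq_conj_mul_self, Complex.add_im, Complex.add_im, h4, smul_eq_mul,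
      smul_eq_mul, smul_eq_mul, Complex.im_ofReal_mul, h3] at h1
    simpa using h1
  have h1 := key 1
  have h2 := key Complex.I
  simp at h1 h2
  apply Complex.ext
  · simp; linarith
  · simp; linarith

/-- The GNS semi-inner product `ω (star A * B)`. -/
@[reducible]
def IsState.preInner (hω : IsState R ω) : PreInnerProductSpace.Core ℂ R.toStarSubalgebra where
  inner A B := ω (star A * B)
  conj_inner_symm A B := by
    rw [← hω.map_star, star_mul, star_star]
  re_inner_nonneg A := (hω.nonneg A).1
  add_left A B C := by rw [star_add, add_mul, map_add]
  smul_left A B c := by rw [star_smul, smul_mul_assoc, map_smul, smul_eq_mul, starRingEnd_apply]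

/-- The Cauchy-Schwarz inequality for states. -/
theorem IsState.norm_map_star_mul_sq_le (hω : IsState R ω) (A B : R.toStarSubalgebra) :
    ‖ω (star A * B)‖ ^ 2 ≤ (ω (star A * A)).re * (ω (star B * B)).re := by
  have h := @InnerProductSpace.Core.inner_mul_inner_self_le ℂ R.toStarSubalgebra _ _ _
    hω.preInner A B
  change ‖ω (star A * B)‖ * ‖ω (star B * A)‖ ≤ _ at h
  have h2 : ‖ω (star B * A)‖ = ‖ω (star A * B)‖ := by
    rw [← RCLike.norm_conj (ω (star A * B)), ← hω.map_star, star_mul, star_star]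
  rw [h2, ← sq] at h
  exact h

theorem IsState.map_isStarProjection (hω : IsState R ω) {p : R.toStarSubalgebra}
    (hp : IsStarProjection p) : 0 ≤ (ω p).re ∧ (ω p).im = 0 := by
  have h : star p * p = p := by rw [hp.isSelfAdjoint.star_eq, hp.isIdempotentElem.eq]
  simpa only [h] using hω.nonneg p

/-- The values of a state on the supports are the terms of a series with partial sums at most `1`.
-/
theorem IsState.tendsto_support_shiftUnit (hω : IsState R ω) {V : R.toStarSubalgebra}
    (hV : star V * V = 1) :
    Tendsto (fun n : ℕ => (ω (support (shiftUnit V (2 * n)))).re) atTop (𝓝 0) := by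
  have h0 : ∀ n : ℕ, 0 ≤ (ω (support (shiftUnit V (2 * n)))).re := fun n =>
    (hω.map_isStarProjection ⟨(isNilpotentPartialIsometry_shiftUnit hV _).support_mul_self,
      isSelfAdjoint_support _⟩).1
  refine (summable_of_sum_range_le (c := 1) h0 fun N => ?_).tendsto_atTop_zero
  have h1 := congrArg (fun A => (ω A).re) (sum_support_shiftUnit hV N)
  have h2 := (hω.nonneg (star V ^ (2 * N))).1
  simp only [map_sum, Complex.re_sum, map_sub, hω.map_one, Complex.sub_re, Complex.one_re, star_pow,
    star_star] at h1 h2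
  linarith

end State

theorem inner_self_eq_ofReal {E : Type*} [NormedAddCommGroup E] [InnerProductSpace ℂ E]
    (x : E) : inner ℂ x x = ((‖x‖ ^ 2 : ℝ) : ℂ) := by
  rw [inner_self_eq_norm_sq_to_K]
  norm_cast

theorem vectorFunctional_star_mul_self (R : VonNeumannAlgebra H) (x : H) (A : R.toStarSubalgebra) :
    vectorFunctional R x (star A * A) = ((‖(A : H →L[ℂ] H) x‖ ^ 2 : ℝ) : ℂ) := by
  change inner ℂ x (ContinuousLinearMap.adjoint (A : H →L[ℂ] H) ((A : H →L[ℂ] H) x)) = _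
  rw [ContinuousLinearMap.adjoint_inner_right, inner_self_eq_ofReal]

theorem isState_vectorFunctional (R : VonNeumannAlgebra H) {x : H} (hx : ‖x‖ = 1) :
    IsState R (vectorFunctional R x) := by
  constructor
  · intro A
    rw [vectorFunctional_star_mul_self]
    exact ⟨by rw [Complex.ofReal_re]; positivity, Complex.ofReal_im _⟩
  · change inner ℂ x x = 1
    rw [inner_self_eq_norm_sq_to_K, hx]
    simp

/-! ### Bell operators concentrated far out -/

/-- Bell operators `R n` that are the identity on a projection `K n` and have an eigenvector `y n`
orthogonal to it with eigenvalue `√2`, where the `K n` exhaust every state. The Schlieder property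
provides the eigenvectors; the two isometries let the supports escape. -/
theorem exists_cutoff_sequence {R₁ R₂ : VonNeumannAlgebra H} (hcomm : R₁ ≤ R₂.commutant)
    (hSchlieder : SchliederProperty R₁ R₂) (h₁ : IsInfiniteType R₁) (h₂ : IsInfiniteType R₂) :
    ∃ (K R : ℕ → (generated R₁ R₂).toStarSubalgebra) (y : ℕ → H),
      (∀ n, IsStarProjection (K n)) ∧ (∀ n, R n ∈ bellOperators R₁ R₂) ∧
      (∀ n, R n * K n = K n) ∧ (∀ n, ‖y n‖ = 1) ∧
      (∀ n, (R n : H →L[ℂ] H) (y n) = ((√2 : ℝ) : ℂ) • y n) ∧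
      (∀ n, (K n : H →L[ℂ] H) (y n) = 0) ∧
      ∀ ω, IsState _ ω → Tendsto (fun n => (ω (1 - K n)).re) atTop (𝓝 0) := by
  obtain ⟨P₁, -, -, hP₁, V₁, hV₁, hV₁', rfl⟩ := h₁
  obtain ⟨P₂, -, -, hP₂, V₂, hV₂, hV₂', rfl⟩ := h₂
  have hc : ∀ A ∈ R₁, ∀ B ∈ R₂, Commute A B := fun A hA B hB =>
    (VonNeumannAlgebra.mem_commutant_iff.1 (hcomm hA) B hB).symm
  have hmem : ∀ (R : VonNeumannAlgebra H) {V : H →L[ℂ] H} (_ : V ∈ R) (n : ℕ), shiftUnit V n ∈ R :=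
    fun R V hV n => mul_mem (mul_mem (pow_mem hV n) (mul_mem hV
      (sub_mem (one_mem R) (mul_mem hV (star_mem hV))))) (pow_mem (star_mem hV) n)
  set W₁ : (generated R₁ R₂).toStarSubalgebra := ⟨V₁, mem_generated_left _ _ hV₁⟩
  set W₂ : (generated R₁ R₂).toStarSubalgebra := ⟨V₂, mem_generated_right _ _ hV₂⟩
  have hW₁' : star W₁ * W₁ = 1 := Subtype.ext hV₁'
  have hW₂' : star W₂ * W₂ = 1 := Subtype.ext hV₂'
  have he := fun n : ℕ => isNilpotentPartialIsometry_shiftUnit hV₁' (2 * n)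
  have hf := fun n : ℕ => isNilpotentPartialIsometry_shiftUnit hV₂' (2 * n)
  have he' := fun n : ℕ => isNilpotentPartialIsometry_shiftUnit hW₁' (2 * n)
  have hf' := fun n : ℕ => isNilpotentPartialIsometry_shiftUnit hW₂' (2 * n)
  have hce : ∀ n : ℕ, Commute (shiftUnit V₁ (2 * n)) (shiftUnit V₂ (2 * n)) := fun n =>
    hc _ (hmem R₁ hV₁ _) _ (hmem R₂ hV₂ _)
  have hce' : ∀ n : ℕ, Commute (shiftUnit V₁ (2 * n)) (star (shiftUnit V₂ (2 * n))) := fun n =>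
    hc _ (hmem R₁ hV₁ _) _ (star_mem (hmem R₂ hV₂ _))
  have hcs : ∀ n : ℕ, Commute (support (shiftUnit W₁ (2 * n))) (support (shiftUnit W₂ (2 * n))) :=
    fun n => Subtype.ext (commute_support (hce n) (hce' n))
  have hy := fun n : ℕ => exists_unit_eigenvector_bellOperator (hce n) (hce' n) (he n) (hf n) (by
    intro h0
    rcases hSchlieder _ (mul_mem (star_mem (hmem R₁ hV₁ _)) (hmem R₁ hV₁ _)) _
      (mul_mem (star_mem (hmem R₂ hV₂ _)) (hmem R₂ hV₂ _)) h0 with h | h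
    · exact star_shiftUnit_mul_self_ne_zero hV₁' hP₁ _ h
    · exact star_shiftUnit_mul_self_ne_zero hV₂' hP₂ _ h)
  choose y hy₁ hy₂ hy₃ using hy
  refine ⟨fun n => cutoff (shiftUnit W₁ (2 * n)) (shiftUnit W₂ (2 * n)),
    fun n => bellOperator (shiftUnit W₁ (2 * n)) (shiftUnit W₂ (2 * n)), y,
    fun n => isStarProjection_cutoff (hcs n) (he' n) (hf' n), fun n => ?_,
    fun n => bellOperator_mul_cutoff (hcs n) (he' n) (hf' n), hy₁, hy₂, hy₃, fun ω hω => ?_⟩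
  · obtain ⟨R, hR, h⟩ := exists_mem_bellOperators_coe_eq (hmem R₁ hV₁ (2 * n)) (hmem R₂ hV₂ (2 * n))
      (he n) (hf n)
    have h2 : bellOperator (shiftUnit W₁ (2 * n)) (shiftUnit W₂ (2 * n)) = R :=
      Subtype.ext h.symm
    change bellOperator (shiftUnit W₁ (2 * n)) (shiftUnit W₂ (2 * n)) ∈ _
    rwa [h2]
  · have hlim := (hω.tendsto_support_shiftUnit hW₁').add (hω.tendsto_support_shiftUnit hW₂')
    rw [add_zero] at hlim
    refine squeeze_zero (fun n => ?_) (fun n => ?_) hlim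
    · exact (hω.map_isStarProjection (isStarProjection_cutoff (hcs n) (he' n) (hf' n)).one_sub).1
    · have h1 := (hω.map_isStarProjection (IsStarProjection.mul
        ⟨(he' n).support_mul_self, isSelfAdjoint_support _⟩
        ⟨(hf' n).support_mul_self, isSelfAdjoint_support _⟩ (hcs n))).1
      have h2 : 1 - cutoff (shiftUnit W₁ (2 * n)) (shiftUnit W₂ (2 * n)) =
          support (shiftUnit W₁ (2 * n)) + support (shiftUnit W₂ (2 * n)) -
          support (shiftUnit W₁ (2 * n)) * support (shiftUnit W₂ (2 * n)) := by
        simp only [cutoff, sub_mul, mul_sub, one_mul, mul_one]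
        abel
      rw [h2, map_sub, map_add, Complex.sub_re, Complex.add_re]
      linarith

/-! ### Strong limits of bounded monotone nets -/

/-- The quadratic form of a positive operator `T = C* C` controls `T`: at `x` it is `‖C x‖²`. -/
theorem norm_apply_sq_le_of_nonneg {T : H →L[ℂ] H} (hT : 0 ≤ T) (x : H) :
    ‖T x‖ ^ 2 ≤ ‖T‖ * (inner ℂ x (T x)).re := by
  obtain ⟨C, rfl⟩ := CStarAlgebra.nonneg_iff_eq_star_mul_self.1 hT
  have h1 : inner ℂ x ((star C * C) x) = ((‖C x‖ ^ 2 : ℝ) : ℂ) := by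
    change inner ℂ x (ContinuousLinearMap.adjoint C (C x)) = _
    rw [ContinuousLinearMap.adjoint_inner_right, inner_self_eq_ofReal]
  rw [h1, CStarRing.norm_star_mul_self, Complex.ofReal_re]
  have h2 : ‖(star C * C) x‖ ≤ ‖C‖ * ‖C x‖ := by
    calc _ = ‖(star C) (C x)‖ := rfl
      _ ≤ ‖star C‖ * ‖C x‖ := (star C).le_opNorm _
      _ = _ := by rw [norm_star]
  calc _ ≤ (‖C‖ * ‖C x‖) ^ 2 := by gcongr
    _ = _ := by ring

theorem re_inner_le_re_inner {E : Type*} [NormedAddCommGroup E] [InnerProductSpace ℂ E]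
    {T U : E →L[ℂ] E} (h : T ≤ U) (x : E) :
    (inner ℂ x (T x)).re ≤ (inner ℂ x (U x)).re := by
  have := ((ContinuousLinearMap.le_def _ _).1 h).re_inner_nonneg_right x
  simp only [sub_apply, inner_sub_right, map_sub] at this
  exact sub_nonneg.1 this

/-- Vigier's theorem: a bounded monotone net of operators converges strongly. -/
theorem exists_tendsto_of_monotone {ι : Type*} [Preorder ι] [IsDirectedOrder ι] [Nonempty ι]
    {T : ι → H →L[ℂ] H} (hT : Monotone T) {L U : H →L[ℂ] H} (hL : ∀ i, L ≤ T i)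
    (hU : ∀ i, T i ≤ U) :
    ∃ S : H →L[ℂ] H, ∀ x, Tendsto (fun i => T i x) atTop (𝓝 (S x)) := by
  have hbdd : ∀ x, BddAbove (Set.range fun i => (inner ℂ x (T i x)).re) := fun x => by
    refine ⟨(inner ℂ x (U x)).re, ?_⟩
    rintro _ ⟨i, rfl⟩
    exact re_inner_le_re_inner (hU i) x
  have hnorm : ∀ i j, i ≤ j → ‖T j - T i‖ ≤ ‖U - L‖ := fun i j hij =>
    CStarAlgebra.norm_le_norm_of_nonneg_of_le (sub_nonneg.2 (hT hij))
      (sub_le_sub (hU j) (hL i))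
  have hlim : ∀ x, ∃ y, Tendsto (fun i => T i x) atTop (𝓝 y) := fun x => by
    apply cauchy_map_iff_exists_tendsto.1
    refine Metric.cauchy_iff.2 ⟨inferInstance, fun ε hε => ?_⟩
    set M := ‖U - L‖ + 1 with hM
    have hM0 : 0 < M := by positivity
    obtain ⟨_, ⟨i, rfl⟩, hi⟩ := exists_lt_of_lt_csSup
      (Set.range_nonempty fun i => (inner ℂ x (T i x)).re)
      (sub_lt_self (sSup (Set.range fun i => (inner ℂ x (T i x)).re))
        (show 0 < (ε / 2) ^ 2 / M by positivity))
    -- Above `i` the quadratic forms at `x` vary little, so the operators do so at `x` as well.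
    have hclose : ∀ j, i ≤ j → ‖T j x - T i x‖ < ε / 2 := fun j hij => by
      have h1 := norm_apply_sq_le_of_nonneg (sub_nonneg.2 (hT hij)) x
      have h2 : (inner ℂ x ((T j - T i) x)).re < (ε / 2) ^ 2 / M := by
        have := le_csSup (hbdd x) ⟨j, rfl⟩
        simp only [sub_apply, inner_sub_right, Complex.sub_re]
        simp only at this hi
        linarith
      have h3 : 0 ≤ (inner ℂ x ((T j - T i) x)).re :=
        ((ContinuousLinearMap.le_def _ _).1 (hT hij)).re_inner_nonneg_right x
      have h4 : ‖(T j - T i) x‖ ^ 2 < (ε / 2) ^ 2 := by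
        calc _ ≤ ‖T j - T i‖ * (inner ℂ x ((T j - T i) x)).re := h1
          _ ≤ M * (inner ℂ x ((T j - T i) x)).re := by
            gcongr
            linarith [hnorm i j hij]
          _ < M * ((ε / 2) ^ 2 / M) := by gcongr
          _ = _ := by field_simp
      exact lt_of_pow_lt_pow_left₀ 2 (by positivity) h4
    refine ⟨(fun j => T j x) '' Set.Ici i, image_mem_map (Ici_mem_atTop i), ?_⟩
    rintro _ ⟨j, hj, rfl⟩ _ ⟨k, hk, rfl⟩
    calc dist (T j x) (T k x) ≤ dist (T j x) (T i x) + dist (T k x) (T i x) :=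
          dist_triangle_right _ _ _
      _ < ε / 2 + ε / 2 := by
          rw [dist_eq_norm, dist_eq_norm]
          exact add_lt_add (hclose j hj) (hclose k hk)
      _ = ε := by ring
  choose f hf using hlim
  have hb : Bornology.IsBounded (Set.range T) := by
    refine isBounded_iff_forall_norm_le.2 ⟨‖U - L‖ + ‖L‖, ?_⟩
    rintro _ ⟨i, rfl⟩
    calc ‖T i‖ = ‖(T i - L) + L‖ := by rw [sub_add_cancel]
      _ ≤ ‖T i - L‖ + ‖L‖ := norm_add_le _ _
      _ ≤ ‖U - L‖ + ‖L‖ := by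
        gcongr 1
        exact CStarAlgebra.norm_le_norm_of_nonneg_of_le (sub_nonneg.2 (hL i))
          (sub_le_sub_right (hU i) L)
  exact ⟨ContinuousLinearMap.ofTendstoOfBoundedRange f T (tendsto_pi_nhds.2 hf) hb, hf⟩

theorem le_of_forall_re_inner_le {T U : H →L[ℂ] H} (hT : IsSelfAdjoint T) (hU : IsSelfAdjoint U)
    (h : ∀ x, (inner ℂ x (T x)).re ≤ (inner ℂ x (U x)).re) : T ≤ U := by
  refine (ContinuousLinearMap.le_def _ _).2
    (ContinuousLinearMap.isPositive_def'.2 ⟨hU.sub hT, fun x => ?_⟩)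
  rw [ContinuousLinearMap.reApplyInnerSelf_apply, inner_re_symm, sub_apply, inner_sub_right,
    map_sub]
  exact sub_nonneg.2 (h x)

/-! ### Normal functionals -/

/-- `S` is the least upper bound, among the operators of `R`, of the nonempty directed set `D` of
self-adjoint operators: the situation in which a normal state is required to be continuous. -/
structure IsDirectedSup (R : VonNeumannAlgebra H) (D : Set R.toStarSubalgebra)
    (S : R.toStarSubalgebra) : Prop where
  nonempty : D.Nonempty
  isSelfAdjoint : ∀ A ∈ D, IsSelfAdjoint A
  directedOn : DirectedOn (fun A B : R.toStarSubalgebra => (A : H →L[ℂ] H) ≤ (B : H →L[ℂ] H)) D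
  le : ∀ A ∈ D, (A : H →L[ℂ] H) ≤ (S : H →L[ℂ] H)
  least : ∀ T : R.toStarSubalgebra, (∀ A ∈ D, (A : H →L[ℂ] H) ≤ (T : H →L[ℂ] H)) →
      (S : H →L[ℂ] H) ≤ (T : H →L[ℂ] H)

theorem isSelfAdjoint_of_le {T U : H →L[ℂ] H} (hT : IsSelfAdjoint T) (h : T ≤ U) :
    IsSelfAdjoint U := by
  have := ((ContinuousLinearMap.le_def _ _).1 h).isSelfAdjoint.add hT
  rwa [sub_add_cancel] at this

/-- A von Neumann algebra is closed under strong limits, being a commutant. -/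
theorem mem_of_tendsto {ι : Type*} {l : Filter ι} [l.NeBot] {T : ι → H →L[ℂ] H} {S : H →L[ℂ] H}
    (hT : ∀ i, T i ∈ R) (h : ∀ x, Tendsto (fun i => T i x) l (𝓝 (S x))) : S ∈ R := by
  rw [← R.commutant_commutant, VonNeumannAlgebra.mem_commutant_iff]
  intro C hC
  ext x
  refine tendsto_nhds_unique ((C.continuous.tendsto _).comp (h x)) ((h (C x)).congr fun i => ?_)
  exact congrArg (fun A : H →L[ℂ] H => A x) (VonNeumannAlgebra.mem_commutant_iff.1 hC _ (hT i))

/-- The least upper bound in `R` is the strong limit of the net, so it is attained in each quadratic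
form. -/
theorem IsDirectedSup.isLUB_re_inner {D : Set R.toStarSubalgebra} {S : R.toStarSubalgebra}
    (h : IsDirectedSup R D S) (x : H) :
    IsLUB ((fun A : R.toStarSubalgebra => (inner ℂ x ((A : H →L[ℂ] H) x)).re) '' D)
      (inner ℂ x ((S : H →L[ℂ] H) x)).re := by
  obtain ⟨A₀, hA₀⟩ := h.nonempty
  -- The net is restricted to the operators above `A₀` to make it bounded below.
  let ι : Set (H →L[ℂ] H) := {T | (∃ A ∈ D, (A : H →L[ℂ] H) = T) ∧ (A₀ : H →L[ℂ] H) ≤ T}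
  have hsa : ∀ A ∈ D, IsSelfAdjoint (A : H →L[ℂ] H) := fun A hA =>
    congrArg Subtype.val (h.isSelfAdjoint A hA)
  have : Nonempty ι := ⟨⟨A₀, ⟨A₀, hA₀, rfl⟩, le_rfl⟩⟩
  have : IsDirectedOrder ι := ⟨by
    rintro ⟨_, ⟨A, hA, rfl⟩, hA'⟩ ⟨_, ⟨B, hB, rfl⟩, hB'⟩
    obtain ⟨C, hC, hAC, hBC⟩ := h.directedOn A hA B hB
    exact ⟨⟨C, ⟨C, hC, rfl⟩, hA'.trans hAC⟩, hAC, hBC⟩⟩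
  obtain ⟨S', hS'⟩ := exists_tendsto_of_monotone (T := fun i : ι => (i : H →L[ℂ] H))
    (fun _ _ hij => hij) (L := A₀) (U := S) (fun i => i.2.2)
    (by rintro ⟨_, ⟨A, hA, rfl⟩, -⟩; exact h.le A hA)
  have hmem : S' ∈ R := mem_of_tendsto (by rintro ⟨_, ⟨A, hA, rfl⟩, -⟩; exact A.2) hS'
  have hsa' : IsSelfAdjoint S' := by
    rw [ContinuousLinearMap.isSelfAdjoint_iff_isSymmetric]
    intro u v
    refine tendsto_nhds_unique ((hS' u).inner tendsto_const_nhds)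
      ((tendsto_const_nhds.inner (hS' v)).congr ?_)
    rintro ⟨_, ⟨A, hA, rfl⟩, -⟩
    exact ((ContinuousLinearMap.isSelfAdjoint_iff_isSymmetric.1 (hsa A hA)) u v).symm
  have hre : ∀ x, Tendsto (fun i : ι => (inner ℂ x ((i : H →L[ℂ] H) x)).re) atTop
      (𝓝 (inner ℂ x (S' x)).re) := fun x =>
    (Complex.continuous_re.tendsto _).comp (tendsto_const_nhds.inner (hS' x))
  have hub : ∀ A ∈ D, (A : H →L[ℂ] H) ≤ S' := fun A hA => by
    refine le_of_forall_re_inner_le (hsa A hA) hsa' fun x => ?_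
    obtain ⟨B, hB, hAB, hA₀B⟩ := h.directedOn A hA A₀ hA₀
    refine ge_of_tendsto (hre x) ((eventually_ge_atTop ⟨B, ⟨B, hB, rfl⟩, hA₀B⟩).mono fun i hi => ?_)
    exact re_inner_le_re_inner (hAB.trans hi) x
  have hS : IsSelfAdjoint (S : H →L[ℂ] H) := isSelfAdjoint_of_le (hsa A₀ hA₀) (h.le A₀ hA₀)
  have hSS' : (S : H →L[ℂ] H) = S' := by
    refine le_antisymm (h.least ⟨S', hmem⟩ hub) (le_of_forall_re_inner_le hsa' hS fun x => ?_)
    refine le_of_tendsto (hre x) (Eventually.of_forall ?_)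
    rintro ⟨_, ⟨A, hA, rfl⟩, -⟩
    exact re_inner_le_re_inner (h.le A hA) x
  constructor
  · rintro _ ⟨A, hA, rfl⟩
    exact re_inner_le_re_inner (h.le A hA) x
  · intro b hb
    rw [hSS']
    refine le_of_tendsto (hre x) (Eventually.of_forall ?_)
    rintro ⟨_, ⟨A, hA, rfl⟩, -⟩
    exact hb ⟨A, hA, rfl⟩

/-- The continuity condition in the definition of a normal state. -/
def PreservesDirectedSups (ω : Functional R) : Prop :=
  ∀ D S, IsDirectedSup R D S → IsLUB ((fun A => (ω A).re) '' D) (ω S).re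

theorem isNormalState_iff {ω : Functional R} :
    IsNormalState R ω ↔ IsState R ω ∧ PreservesDirectedSups ω :=
  ⟨fun h => ⟨h.toIsState, fun D S hD =>
    h.map_isLUB D S hD.nonempty hD.isSelfAdjoint hD.directedOn hD.le hD.least⟩,
  fun h => ⟨h.1, fun D S h1 h2 h3 h4 h5 => h.2 D S ⟨h1, h2, h3, h4, h5⟩⟩⟩

theorem preservesDirectedSups_vectorFunctional (x : H) :
    PreservesDirectedSups (vectorFunctional R x) := fun _ _ h => h.isLUB_re_inner x

namespace PreservesDirectedSups

variable {φ ψ : Functional R}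

/-- The pair `{A, B}` is directed with least upper bound `B`. -/
theorem map_le_map (hφ : PreservesDirectedSups φ) {A B : R.toStarSubalgebra}
    (hA : IsSelfAdjoint A) (hB : IsSelfAdjoint B) (hAB : (A : H →L[ℂ] H) ≤ B) :
    (φ A).re ≤ (φ B).re := by
  have hle : ∀ C ∈ ({A, B} : Set R.toStarSubalgebra), (C : H →L[ℂ] H) ≤ B := by
    rintro C (rfl | rfl)
    exacts [hAB, le_rfl]
  refine (hφ {A, B} B ⟨⟨A, by simp⟩, ?_, fun C hC E hE => ⟨B, by simp, hle C hC, hle E hE⟩, hle,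
    fun T hT => hT B (by simp)⟩).1 ⟨A, by simp, rfl⟩
  rintro C (rfl | rfl) <;> assumption

theorem add (hφ : PreservesDirectedSups φ) (hψ : PreservesDirectedSups ψ) :
    PreservesDirectedSups (φ + ψ) := by
  intro D S h
  constructor
  · rintro _ ⟨A, hA, rfl⟩
    exact add_le_add ((hφ D S h).1 ⟨A, hA, rfl⟩) ((hψ D S h).1 ⟨A, hA, rfl⟩)
  · intro b hb
    have h1 : ∀ A ∈ D, ∀ B ∈ D, (φ A).re + (ψ B).re ≤ b := fun A hA B hB => by
      obtain ⟨C, hC, hAC, hBC⟩ := h.directedOn A hA B hB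
      have h2 := hφ.map_le_map (h.isSelfAdjoint A hA) (h.isSelfAdjoint C hC) hAC
      have h3 := hψ.map_le_map (h.isSelfAdjoint B hB) (h.isSelfAdjoint C hC) hBC
      exact (add_le_add h2 h3).trans (hb ⟨C, hC, rfl⟩)
    have h2 : ∀ B ∈ D, (φ S).re ≤ b - (ψ B).re := fun B hB => (hφ D S h).2 (by
      rintro _ ⟨A, hA, rfl⟩
      exact le_sub_iff_add_le.2 (h1 A hA B hB))
    have h3 : (ψ S).re ≤ b - (φ S).re := (hψ D S h).2 (by
      rintro _ ⟨B, hB, rfl⟩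
      have := h2 B hB
      change (ψ B).re ≤ _
      linarith)
    change (φ S).re + (ψ S).re ≤ b
    linarith

theorem smul (hφ : PreservesDirectedSups φ) {c : ℝ} (hc : 0 < c) :
    PreservesDirectedSups ((c : ℂ) • φ) := by
  have key : ∀ A, (((c : ℂ) • φ) A).re = c * (φ A).re := fun A => Complex.re_ofReal_mul _ _
  intro D S h
  simp only [key]
  constructor
  · rintro _ ⟨A, hA, rfl⟩
    exact mul_le_mul_of_nonneg_left ((hφ D S h).1 ⟨A, hA, rfl⟩) hc.le
  · intro b hb
    rw [← le_div_iff₀' hc]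
    refine (hφ D S h).2 ?_
    rintro _ ⟨A, hA, rfl⟩
    exact (le_div_iff₀' hc).2 (hb ⟨A, hA, rfl⟩)

end PreservesDirectedSups

theorem inner_conjugate {K : R.toStarSubalgebra} (hK : IsSelfAdjoint K) (A : R.toStarSubalgebra)
    (x : H) : inner ℂ x (((K * A * K : R.toStarSubalgebra) : H →L[ℂ] H) x) =
      inner ℂ ((K : H →L[ℂ] H) x) ((A : H →L[ℂ] H) ((K : H →L[ℂ] H) x)) := by
  have hK' : IsSelfAdjoint (K : H →L[ℂ] H) := congrArg Subtype.val hK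
  exact ((ContinuousLinearMap.isSelfAdjoint_iff_isSymmetric.1 hK') x _).symm

theorem IsDirectedSup.conjugate {D : Set R.toStarSubalgebra} {S : R.toStarSubalgebra}
    (h : IsDirectedSup R D S) {K : R.toStarSubalgebra} (hK : IsSelfAdjoint K) :
    IsDirectedSup R ((fun A => K * A * K) '' D) (K * S * K) := by
  have hsa : ∀ A : R.toStarSubalgebra, IsSelfAdjoint A → IsSelfAdjoint (K * A * K) := fun A hA => by
    simpa [hK.star_eq] using hA.conjugate K
  have hcoe : ∀ A : R.toStarSubalgebra, IsSelfAdjoint A → IsSelfAdjoint (A : H →L[ℂ] H) :=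
    fun A hA => congrArg Subtype.val hA
  obtain ⟨A₀, hA₀⟩ := h.nonempty
  have hS : IsSelfAdjoint S := Subtype.ext
    (isSelfAdjoint_of_le (hcoe _ (h.isSelfAdjoint A₀ hA₀)) (h.le A₀ hA₀))
  have hle : ∀ A B : R.toStarSubalgebra, IsSelfAdjoint A → IsSelfAdjoint B →
      (A : H →L[ℂ] H) ≤ B → ((K * A * K : R.toStarSubalgebra) : H →L[ℂ] H) ≤
        (K * B * K : R.toStarSubalgebra) := fun A B hA hB hAB => by
    refine le_of_forall_re_inner_le (hcoe _ (hsa A hA)) (hcoe _ (hsa B hB)) fun x => ?_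
    rw [inner_conjugate hK, inner_conjugate hK]
    exact re_inner_le_re_inner hAB _
  refine ⟨h.nonempty.image _, ?_, ?_, ?_, ?_⟩
  · rintro _ ⟨A, hA, rfl⟩
    exact hsa A (h.isSelfAdjoint A hA)
  · rintro _ ⟨A, hA, rfl⟩ _ ⟨B, hB, rfl⟩
    obtain ⟨C, hC, hAC, hBC⟩ := h.directedOn A hA B hB
    exact ⟨_, ⟨C, hC, rfl⟩, hle A C (h.isSelfAdjoint A hA) (h.isSelfAdjoint C hC) hAC,
      hle B C (h.isSelfAdjoint B hB) (h.isSelfAdjoint C hC) hBC⟩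
  · rintro _ ⟨A, hA, rfl⟩
    exact hle A S (h.isSelfAdjoint A hA) hS (h.le A hA)
  · intro T hT
    have hTsa : IsSelfAdjoint (T : H →L[ℂ] H) := isSelfAdjoint_of_le
      (hcoe _ (hsa _ (h.isSelfAdjoint A₀ hA₀))) (hT _ ⟨A₀, hA₀, rfl⟩)
    refine le_of_forall_re_inner_le (hcoe _ (hsa S hS)) hTsa fun x => ?_
    rw [inner_conjugate hK]
    refine (h.isLUB_re_inner ((K : H →L[ℂ] H) x)).2 ?_
    rintro _ ⟨A, hA, rfl⟩
    change (inner ℂ ((K : H →L[ℂ] H) x) ((A : H →L[ℂ] H) ((K : H →L[ℂ] H) x))).re ≤ _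
    rw [← inner_conjugate hK]
    exact re_inner_le_re_inner (hT _ ⟨A, hA, rfl⟩) x

/-- The functional `A ↦ ω (K A K)`. -/
def compress (ω : Functional R) (K : R.toStarSubalgebra) : Functional R :=
  ω.comp (ContinuousLinearMap.mulLeftRight ℂ R.toStarSubalgebra K K)

theorem PreservesDirectedSups.compress {ω : Functional R} (hω : PreservesDirectedSups ω)
    {K : R.toStarSubalgebra} (hK : IsSelfAdjoint K) : PreservesDirectedSups (compress ω K) := by
  intro D S h
  have := hω _ _ (h.conjugate hK)
  rwa [Set.image_image] at this

/-! ### Bell correlation as an open condition -/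

/-- A crude bound on the observables; it serves only to show that `β` is a supremum over a bounded
set, as `sSup` is a junk value otherwise. -/
theorem norm_le_three {A : H →L[ℂ] H} (h₁ : -1 ≤ A) (h₂ : A ≤ 1) : ‖A‖ ≤ 3 := by
  have h1 : ‖(1 : H →L[ℂ] H)‖ ≤ 1 := ContinuousLinearMap.norm_id_le
  have h2 : ‖A - -1‖ ≤ ‖(1 : H →L[ℂ] H) - -1‖ :=
    CStarAlgebra.norm_le_norm_of_nonneg_of_le (sub_nonneg.2 h₁) (sub_le_sub_right h₂ _)
  have h3 : ‖(1 : H →L[ℂ] H) - -1‖ ≤ 2 := by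
    rw [sub_neg_eq_add]
    linarith [norm_add_le (1 : H →L[ℂ] H) 1]
  calc ‖A‖ = ‖(A - -1) - 1‖ := by simp
    _ ≤ ‖A - -1‖ + ‖(1 : H →L[ℂ] H)‖ := norm_sub_le _ _
    _ ≤ 3 := by linarith

theorem exists_norm_le_of_mem_bellOperators (R₁ R₂ : VonNeumannAlgebra H) :
    ∃ C : ℝ, ∀ R ∈ bellOperators R₁ R₂, ‖R‖ ≤ C := by
  refine ⟨18, ?_⟩
  rintro R ⟨A₁, -, A₂, -, B₁, -, B₂, -, ⟨-, hA₁, hA₁'⟩, ⟨-, hA₂, hA₂'⟩, ⟨-, hB₁, hB₁'⟩,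
    ⟨-, hB₂, hB₂'⟩, hR⟩
  have a₁ := norm_le_three hA₁ hA₁'
  have a₂ := norm_le_three hA₂ hA₂'
  have b₁ := norm_le_three hB₁ hB₁'
  have b₂ := norm_le_three hB₂ hB₂'
  change ‖(R : H →L[ℂ] H)‖ ≤ 18
  rw [hR]
  have h1 : ‖A₁ * (B₁ + B₂)‖ ≤ 3 * (3 + 3) := (norm_mul_le _ _).trans (by
    gcongr
    exact (norm_add_le _ _).trans (add_le_add b₁ b₂))
  have h2 : ‖A₂ * (B₁ - B₂)‖ ≤ 3 * (3 + 3) := (norm_mul_le _ _).trans (by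
    gcongr
    exact (norm_sub_le _ _).trans (add_le_add b₁ b₂))
  calc _ ≤ ‖(1 / 2 : ℂ)‖ * ‖A₁ * (B₁ + B₂) + A₂ * (B₁ - B₂)‖ := norm_smul_le _ _
    _ ≤ (1 / 2) * (3 * (3 + 3) + 3 * (3 + 3)) := by
      gcongr
      · norm_num
      · exact (norm_add_le _ _).trans (add_le_add h1 h2)
    _ = 18 := by norm_num

theorem isBellCorrelated_iff {R₁ R₂ : VonNeumannAlgebra H} (ω : Functional (generated R₁ R₂)) :
    IsBellCorrelated R₁ R₂ ω ↔ ∃ R ∈ bellOperators R₁ R₂, 1 < ‖ω R‖ := by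
  have h0 : (0 : (generated R₁ R₂).toStarSubalgebra) ∈ bellOperators R₁ R₂ :=
    ⟨0, zero_mem _, 0, zero_mem _, 0, zero_mem _, 0, zero_mem _, by simp, by simp, by simp, by simp,
      by simp⟩
  constructor
  · intro h
    obtain ⟨_, ⟨R, hR, rfl⟩, h1⟩ := exists_lt_of_lt_csSup (Set.Nonempty.image _ ⟨0, h0⟩) h
    exact ⟨R, hR, h1⟩
  · rintro ⟨R, hR, h⟩
    obtain ⟨C, hC⟩ := exists_norm_le_of_mem_bellOperators R₁ R₂
    refine h.trans_le (le_csSup ⟨‖ω‖ * C, ?_⟩ ⟨R, hR, rfl⟩)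
    rintro _ ⟨T, hT, rfl⟩
    exact (ω.le_opNorm T).trans (by gcongr; exact hC T hT)

theorem isOpen_setOf_isBellCorrelated_vectorFunctional (R₁ R₂ : VonNeumannAlgebra H) :
    IsOpen {x : H | IsBellCorrelated R₁ R₂ (vectorFunctional (generated R₁ R₂) x)} := by
  simp only [isBellCorrelated_iff, vectorFunctional_apply, Set.ofPred_exists]
  refine isOpen_iUnion fun R => ?_
  by_cases hR : R ∈ bellOperators R₁ R₂
  · simp only [hR, true_and]
    exact isOpen_lt continuous_const
      (continuous_id.inner ((R : H →L[ℂ] H).continuous)).norm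
  · simp [hR]

/-! ### Bell correlated perturbations of vectors and states -/

section Perturbation

variable {R₁ R₂ : VonNeumannAlgebra H} {K R : (generated R₁ R₂).toStarSubalgebra} {y : H}

theorem one_lt_sqrt_two : 1 < √2 := by
  rw [Real.lt_sqrt] <;> norm_num

/-- The vector `z = K x + ε y` is an orthogonal sum of eigenvectors of the Bell operator `R` with
eigenvalues `1` and `√2`, so the expectation of `R` in its direction exceeds `1`. -/
theorem isBellCorrelated_normalize (hK : IsStarProjection K) (hR : R ∈ bellOperators R₁ R₂)
    (hRK : R * K = K) (hy : ‖y‖ = 1) (hRy : (R : H →L[ℂ] H) y = ((√2 : ℝ) : ℂ) • y)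
    (hKy : (K : H →L[ℂ] H) y = 0) (x : H) {ε : ℝ} (hε : 0 < ε) :
    IsBellCorrelated R₁ R₂ (vectorFunctional _
      ((‖(K : H →L[ℂ] H) x + (ε : ℂ) • y‖⁻¹ : ℂ) • ((K : H →L[ℂ] H) x + (ε : ℂ) • y))) ∧
    (K : H →L[ℂ] H) x + (ε : ℂ) • y ≠ 0 := by
  have hK' : IsSelfAdjoint (K : H →L[ℂ] H) := congrArg Subtype.val hK.isSelfAdjoint
  set u := (K : H →L[ℂ] H) x with hu
  have horth : inner ℂ u y = 0 := by
    have := (ContinuousLinearMap.isSelfAdjoint_iff_isSymmetric.1 hK') x y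
    exact this.trans (by
      change inner ℂ x ((K : H →L[ℂ] H) y) = 0
      rw [hKy, inner_zero_right])
  have horth' : inner ℂ y u = 0 := inner_eq_zero_symm.1 horth
  have hRu : (R : H →L[ℂ] H) u = u :=
    congrArg (fun A : (generated R₁ R₂).toStarSubalgebra => (A : H →L[ℂ] H) x) hRK
  set z := u + (ε : ℂ) • y with hz
  have hyy : inner ℂ y y = 1 := by simp [inner_self_eq_norm_sq_to_K, hy]
  have huu := inner_self_eq_ofReal u
  have hval : inner ℂ z ((R : H →L[ℂ] H) z) = ((‖u‖ ^ 2 + √2 * ε ^ 2 : ℝ) : ℂ) := by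
    rw [hz, map_add, map_smul, hRu, hRy]
    simp only [inner_add_left, inner_add_right, inner_smul_left, inner_smul_right, horth, horth',
      hyy, huu]
    simp
    ring
  have hnorm : ‖z‖ ^ 2 = ‖u‖ ^ 2 + ε ^ 2 := by
    have h : inner ℂ z z = ((‖u‖ ^ 2 + ε ^ 2 : ℝ) : ℂ) := by
      rw [hz]
      simp only [inner_add_left, inner_add_right, inner_smul_left, inner_smul_right, horth, horth',
        hyy, huu]
      simp
      ring
    exact Complex.ofReal_injective ((inner_self_eq_ofReal z).symm.trans h)
  have hz0 : 0 < ‖z‖ := norm_pos_iff.2 fun h => by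
    have : 0 < ‖z‖ ^ 2 := by rw [hnorm]; positivity
    simp [h] at this
  refine ⟨(isBellCorrelated_iff _).2 ⟨R, hR, ?_⟩, norm_pos_iff.1 hz0⟩
  rw [vectorFunctional_apply, map_smul, inner_smul_left, inner_smul_right, hval]
  have hc : starRingEnd ℂ (‖z‖⁻¹ : ℂ) * ((‖z‖⁻¹ : ℂ) * ((‖u‖ ^ 2 + √2 * ε ^ 2 : ℝ) : ℂ)) =
      (((‖u‖ ^ 2 + √2 * ε ^ 2) / ‖z‖ ^ 2 : ℝ) : ℂ) := by
    rw [map_inv₀, Complex.conj_ofReal]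
    push_cast
    field_simp
  rw [hc, Complex.norm_real, Real.norm_eq_abs]
  refine lt_of_lt_of_le ?_ (le_abs_self _)
  rw [lt_div_iff₀ (by positivity), hnorm]
  nlinarith [one_lt_sqrt_two, pow_pos hε 2]

/-- The functional `ω (K · K)` with an admixture `ε` of the vector functional of `y`, normalized. -/
def perturb (ω : Functional (generated R₁ R₂)) (K : (generated R₁ R₂).toStarSubalgebra) (y : H)
    (ε : ℝ) : Functional (generated R₁ R₂) :=
  ((((ω K).re + ε)⁻¹ : ℝ) : ℂ) • (compress ω K + (ε : ℂ) • vectorFunctional _ y)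

variable {ω : Functional (generated R₁ R₂)}

theorem perturb_apply (ε : ℝ) (A : (generated R₁ R₂).toStarSubalgebra) :
    perturb ω K y ε A = ((((ω K).re + ε)⁻¹ : ℝ) : ℂ) *
      (ω (K * A * K) + (ε : ℂ) * inner ℂ y ((A : H →L[ℂ] H) y)) := rfl

theorem isNormalState_perturb (hω : IsNormalState _ ω) (hK : IsStarProjection K) (hy : ‖y‖ = 1)
    {ε : ℝ} (hε : 0 < ε) : IsNormalState _ (perturb ω K y ε) := by
  have hK0 := hω.toIsState.map_isStarProjection hK
  have hpos : 0 < (ω K).re + ε := by linarith [hK0.1]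
  refine isNormalState_iff.2 ⟨⟨fun A => ?_, ?_⟩, ?_⟩
  · have h1 := hω.nonneg (A * K)
    have h2 := (isState_vectorFunctional (generated R₁ R₂) hy).nonneg A
    rw [star_mul, hK.isSelfAdjoint.star_eq, show K * star A * (A * K) = K * (star A * A) * K by
      simp only [mul_assoc]] at h1
    rw [vectorFunctional_apply] at h2
    rw [perturb_apply, Complex.re_ofReal_mul, Complex.im_ofReal_mul, Complex.add_re, Complex.add_im,
      Complex.re_ofReal_mul, Complex.im_ofReal_mul, h1.2, h2.2]
    refine ⟨mul_nonneg (inv_nonneg.2 hpos.le) (add_nonneg h1.1 (mul_nonneg hε.le h2.1)), by simp⟩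
  · have h1 : ω K = ((ω K).re : ℂ) := Complex.ext rfl (by simp [hK0.2])
    have h2 : inner ℂ y (((1 : (generated R₁ R₂).toStarSubalgebra) : H →L[ℂ] H) y) = 1 :=
      (isState_vectorFunctional (generated R₁ R₂) hy).map_one
    rw [perturb_apply, h2, mul_one, hK.isIdempotentElem.eq, h1, Complex.ofReal_re, mul_one,
      ← Complex.ofReal_add, ← Complex.ofReal_mul, inv_mul_cancel₀ hpos.ne', Complex.ofReal_one]
  · exact (((isNormalState_iff.1 hω).2.compress hK.isSelfAdjoint).add
      ((preservesDirectedSups_vectorFunctional y).smul hε)).smul (inv_pos.2 hpos)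

theorem isBellCorrelated_perturb (hω : IsState _ ω) (hK : IsStarProjection K)
    (hR : R ∈ bellOperators R₁ R₂) (hRK : R * K = K) (hy : ‖y‖ = 1)
    (hRy : (R : H →L[ℂ] H) y = ((√2 : ℝ) : ℂ) • y) {ε : ℝ} (hε : 0 < ε) :
    IsBellCorrelated R₁ R₂ (perturb ω K y ε) := by
  have hK0 := hω.map_isStarProjection hK
  have hpos : 0 < (ω K).re + ε := by linarith [hK0.1]
  refine (isBellCorrelated_iff _).2 ⟨R, hR, ?_⟩
  have h1 : ω K = ((ω K).re : ℂ) := Complex.ext rfl (by simp [hK0.2])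
  have hyy : inner ℂ y y = 1 := by simp [inner_self_eq_norm_sq_to_K, hy]
  have h2 : perturb ω K y ε R = ((((ω K).re + ε)⁻¹ * ((ω K).re + ε * √2) : ℝ) : ℂ) := by
    rw [perturb_apply, hRy, inner_smul_right, hyy, mul_assoc K, hRK, hK.isIdempotentElem.eq]
    nth_rewrite 2 [h1]
    push_cast
    ring
  rw [h2, Complex.norm_real, Real.norm_eq_abs]
  refine lt_of_lt_of_le ?_ (le_abs_self _)
  rw [inv_mul_eq_div, lt_div_iff₀ hpos]
  nlinarith [one_lt_sqrt_two]

end Perturbation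

/-! ### Convergence of the perturbed states -/

/-- By Cauchy-Schwarz, cutting a state off to a projection of value near `1` moves it little in
norm. -/
theorem IsState.norm_sub_compress_le {R : VonNeumannAlgebra H} {ω : Functional R}
    (hω : IsState R ω) {K : R.toStarSubalgebra} (hK : IsStarProjection K) :
    ‖ω - compress ω K‖ ≤ 2 * √((ω (1 - K)).re * ‖ω‖) := by
  have hD := hK.one_sub
  have hbound : ∀ A : R.toStarSubalgebra, (ω (star A * A)).re ≤ ‖ω‖ * ‖A‖ ^ 2 := fun A => by
    calc (ω (star A * A)).re ≤ ‖ω (star A * A)‖ := Complex.re_le_norm _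
      _ ≤ ‖ω‖ * ‖star A * A‖ := ω.le_opNorm _
      _ = _ := by rw [CStarRing.norm_star_mul_self, sq]
  have hd0 := (hω.map_isStarProjection hD).1
  have hDD : ω (star (1 - K) * (1 - K)) = ω (1 - K) := by
    rw [hD.isSelfAdjoint.star_eq, hD.isIdempotentElem.eq]
  have hleft : ∀ A : R.toStarSubalgebra,
      ‖ω ((1 - K) * A)‖ ≤ √((ω (1 - K)).re * ‖ω‖) * ‖A‖ := fun A => by
    have h := hω.norm_map_star_mul_sq_le (1 - K) A
    rw [hDD, hD.isSelfAdjoint.star_eq] at h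
    refine abs_le_of_sq_le_sq' ?_ (by positivity) |>.2
    rw [mul_pow, Real.sq_sqrt (by positivity)]
    calc _ ≤ _ := h
      _ ≤ (ω (1 - K)).re * (‖ω‖ * ‖A‖ ^ 2) := by gcongr; exact hbound A
      _ = _ := by ring
  have hright : ∀ A : R.toStarSubalgebra,
      ‖ω (A * (1 - K))‖ ≤ √((ω (1 - K)).re * ‖ω‖) * ‖A‖ := fun A => by
    have h := hleft (star A)
    rw [norm_star] at h
    rwa [← RCLike.norm_conj, ← hω.map_star, star_mul, hD.isSelfAdjoint.star_eq]
  refine ContinuousLinearMap.opNorm_le_bound _ (by positivity) fun A => ?_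
  have h1 : (ω - compress ω K) A = ω ((1 - K) * A) + ω (K * A * (1 - K)) := by
    change ω A - ω (K * A * K) = _
    rw [← map_sub, ← map_add]
    congr 1
    simp only [sub_mul, mul_sub, one_mul, mul_one]
    abel
  have hKA : ‖K * A‖ ≤ ‖A‖ := (norm_mul_le _ _).trans
    (mul_le_of_le_one_left (norm_nonneg _) hK.norm_le)
  rw [h1]
  calc _ ≤ ‖ω ((1 - K) * A)‖ + ‖ω (K * A * (1 - K))‖ := norm_add_le _ _
    _ ≤ √((ω (1 - K)).re * ‖ω‖) * ‖A‖ + √((ω (1 - K)).re * ‖ω‖) * ‖A‖ := by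
      refine add_le_add (hleft A) ((hright (K * A)).trans ?_)
      gcongr
    _ = _ := by ring

theorem norm_vectorFunctional_le (R : VonNeumannAlgebra H) {y : H} (hy : ‖y‖ = 1) :
    ‖vectorFunctional R y‖ ≤ 1 := by
  refine ContinuousLinearMap.opNorm_le_bound _ zero_le_one fun A => ?_
  rw [vectorFunctional_apply]
  calc _ ≤ ‖y‖ * ‖(A : H →L[ℂ] H) y‖ := norm_inner_le_norm _ _
    _ ≤ ‖y‖ * (‖(A : H →L[ℂ] H)‖ * ‖y‖) := by gcongr; exact (A : H →L[ℂ] H).le_opNorm y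
    _ = 1 * ‖A‖ := by rw [hy, one_mul, mul_one, one_mul]; rfl

theorem tendsto_perturb {R₁ R₂ : VonNeumannAlgebra H} {ω : Functional (generated R₁ R₂)}
    (hω : IsState _ ω) {K : ℕ → (generated R₁ R₂).toStarSubalgebra} {y : ℕ → H} {ε : ℕ → ℝ}
    (hK : ∀ n, IsStarProjection (K n)) (hy : ∀ n, ‖y n‖ = 1) (hε : Tendsto ε atTop (𝓝 0))
    (hlim : Tendsto (fun n => (ω (1 - K n)).re) atTop (𝓝 0)) :
    Tendsto (fun n => perturb ω (K n) (y n) (ε n)) atTop (𝓝 ω) := by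
  have h1 : Tendsto (fun n => (((((ω (K n)).re + ε n)⁻¹ : ℝ)) : ℂ)) atTop (𝓝 1) := by
    have h : Tendsto (fun n => (ω (K n)).re + ε n) atTop (𝓝 1) := by
      have := (hlim.const_sub 1).add hε
      simpa [map_sub, hω.map_one] using this
    have h' := (Complex.continuous_ofReal.tendsto _).comp (h.inv₀ one_ne_zero)
    simpa [Function.comp_def] using h'
  have h2 : Tendsto (fun n => compress ω (K n)) atTop (𝓝 ω) := by
    rw [tendsto_iff_norm_sub_tendsto_zero]
    have hs : Tendsto (fun n => 2 * √((ω (1 - K n)).re * ‖ω‖)) atTop (𝓝 0) := by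
      have := ((hlim.mul_const ‖ω‖).sqrt).const_mul 2
      simpa using this
    refine squeeze_zero (fun n => norm_nonneg _) (fun n => ?_) hs
    rw [norm_sub_rev]
    exact hω.norm_sub_compress_le (hK n)
  have h3 : Tendsto (fun n => (ε n : ℂ) • vectorFunctional (generated R₁ R₂) (y n)) atTop
      (𝓝 0) := by
    rw [tendsto_zero_iff_norm_tendsto_zero]
    refine squeeze_zero (fun n => norm_nonneg _) (fun n => ?_)
      (by simpa using hε.abs : Tendsto (fun n => |ε n|) atTop (𝓝 0))
    calc _ ≤ ‖(ε n : ℂ)‖ * ‖vectorFunctional (generated R₁ R₂) (y n)‖ := norm_smul_le _ _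
      _ ≤ |ε n| * 1 := by
        rw [Complex.norm_real, Real.norm_eq_abs]
        gcongr
        exact norm_vectorFunctional_le _ (hy n)
      _ = _ := mul_one _
  have h4 := h1.smul (h2.add h3)
  rwa [add_zero, one_smul] at h4

end BellCorrelation

end

theorem proposition1 {H : Type*} [NormedAddCommGroup H] [InnerProductSpace ℂ H] [CompleteSpace H]
    (R₁ R₂ : VonNeumannAlgebra H) (hcomm : R₁ ≤ R₂.commutant)
    (hSchlieder : BellCorrelation.SchliederProperty R₁ R₂)
    (h₁ : BellCorrelation.IsInfiniteType R₁) (h₂ : BellCorrelation.IsInfiniteType R₂) :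
    (IsOpen {x : Metric.sphere (0 : H) 1 | BellCorrelation.IsBellCorrelated R₁ R₂
        (BellCorrelation.vectorFunctional (BellCorrelation.generated R₁ R₂) (x : H))} ∧
      Dense {x : Metric.sphere (0 : H) 1 | BellCorrelation.IsBellCorrelated R₁ R₂
        (BellCorrelation.vectorFunctional (BellCorrelation.generated R₁ R₂) (x : H))}) ∧
    Dense {ω : BellCorrelation.normalStateSpace (BellCorrelation.generated R₁ R₂) |
      BellCorrelation.IsBellCorrelated R₁ R₂
        (ω : BellCorrelation.Functional (BellCorrelation.generated R₁ R₂))} := by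
  open BellCorrelation in
  obtain ⟨K, R, y, hK, hR, hRK, hy, hRy, hKy, hlim⟩ :=
    exists_cutoff_sequence hcomm hSchlieder h₁ h₂
  have hε : Filter.Tendsto (fun n : ℕ => 1 / ((n : ℝ) + 1)) Filter.atTop (nhds 0) :=
    tendsto_one_div_add_atTop_nhds_zero_nat
  have hε0 : ∀ n : ℕ, 0 < 1 / ((n : ℝ) + 1) := fun n => by positivity
  refine ⟨⟨(isOpen_setOf_isBellCorrelated_vectorFunctional R₁ R₂).preimage
    continuous_subtype_val, fun x => ?_⟩, fun ω => ?_⟩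
  · have hx : ‖(x : H)‖ = 1 := mem_sphere_zero_iff_norm.1 x.2
    have hcorr := fun n => isBellCorrelated_normalize (hK n) (hR n) (hRK n) (hy n) (hRy n) (hKy n)
      (x : H) (hε0 n)
    have hKx : Filter.Tendsto (fun n => (K n : H →L[ℂ] H) x) Filter.atTop (nhds (x : H)) := by
      have hl := hlim _ (isState_vectorFunctional _ hx)
      rw [tendsto_iff_norm_sub_tendsto_zero]
      -- `1 - K n` is a projection.
      have hsq : ∀ n, ‖(K n : H →L[ℂ] H) x - x‖ =
          √(vectorFunctional (generated R₁ R₂) (x : H) (1 - K n)).re := fun n => by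
        have h := vectorFunctional_star_mul_self (generated R₁ R₂) (x : H) (1 - K n)
        rw [(hK n).one_sub.isSelfAdjoint.star_eq, (hK n).one_sub.isIdempotentElem.eq] at h
        rw [h, Complex.ofReal_re, Real.sqrt_sq (norm_nonneg _), norm_sub_rev]
        rfl
      simp only [hsq]
      simpa using hl.sqrt
    have hz : Filter.Tendsto (fun n : ℕ => (K n : H →L[ℂ] H) x +
        ((1 / ((n : ℝ) + 1) : ℝ) : ℂ) • y n) Filter.atTop (nhds (x : H)) := by
      have h0 : Filter.Tendsto (fun n : ℕ => ((1 / ((n : ℝ) + 1) : ℝ) : ℂ) • y n) Filter.atTop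
          (nhds 0) := by
        rw [tendsto_zero_iff_norm_tendsto_zero]
        refine hε.congr fun n => ?_
        rw [norm_smul, hy, mul_one, Complex.norm_real, Real.norm_of_nonneg (hε0 n).le]
      simpa using hKx.add h0
    refine mem_closure_of_tendsto (b := Filter.atTop) (f := fun n : ℕ => (⟨_,
      mem_sphere_zero_iff_norm.2 (norm_smul_inv_norm (𝕜 := ℂ) (hcorr n).2)⟩ :
        Metric.sphere (0 : H) 1)) ?_ (Filter.Eventually.of_forall fun n => (hcorr n).1)
    rw [tendsto_subtype_rng]
    have h1 := (((Complex.continuous_ofReal.tendsto _).comp hz.norm).inv₀ (by simp [hx])).smul hz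
    simpa [hx] using h1
  · refine mem_closure_of_tendsto (b := Filter.atTop) (f := fun n : ℕ => (⟨_,
      isNormalState_perturb ω.2 (hK n) (hy n) (hε0 n)⟩ : normalStateSpace (generated R₁ R₂)))
      ?_ (Filter.Eventually.of_forall fun n => isBellCorrelated_perturb ω.2.toIsState (hK n) (hR n)
        (hRK n) (hy n) (hRy n) (hε0 n))
    rw [tendsto_subtype_rng]
    exact tendsto_perturb ω.2.toIsState hK hy hε (hlim _ ω.2.toIsState)
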